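/- Let $\mathcal Z,\mathcal S$ be finite alphabets and $\mathcal X,\mathcal Y$ discrete alphabets; logarithms in information quantities are to base $2$. Let $t(y|x)$ and $u(z|x,s)$ be conditional probability distributions and $q$ a probability distribution on $\mathcal S$. An encoder is a random function $F:\mathcal M\to\mathcal X^n$ on a finite message set, a decoder is a map $\theta:\mathcal Y^n\to\mathcal M$. On input $x^n$ (and state sequence $s^n$) the decoder receives $y^n$ with probability $\prod_i t(y_i|x_i)$ and the eavesdropper receives $z^n$ with probability $\prod_i u(z_i|x_i,s_i)$. Let $M$ be uniform on $\mathcal M$. The pair $(F,\theta)$ is an $(n,r,\epsilon,\delta)$ code for WTC-I$(t,u,q)$ if $$|\mathcal M|=2^{nr},\qquad |\mathcal M|^{-1}\sum_{m}\Pr(\theta(Y^n)=m\mid X^n=F(m))\ge 1-\epsilon,\qquad \mathbb I(Z^n;M\mid S^n)\le\delta,$$ where $S^n$ is i.i.d. with law $q$, independent of $M$ and of the encoder. It is an $(n,r,\epsilon,\delta)$ code for WTC-II$(t,u,q)$ if the first two conditions hold and $\mathbb I(Z^n;M\mid S^n=s^n)\le\delta$ for every $s^n$ in $\mathcal T_q^n$,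 the set of sequences in $\mathcal S^n$ with empirical distribution $q$. For $\upsilon^*\in\mathrm{Sym}\{1,\dots,N\}$ the sequence permutation $\upsilon$ is $\upsilon(x^N)=(x_{\upsilon^*(1)},\dots,x_{\upsilon^*(N)})$. Given codes $F:\mathcal M\to\mathcal X^n$, $\theta:\mathcal Y^n\to\mathcal M$ and $G:\mathcal M^*\to\mathcal X^\kappa$, $\varphi:\mathcal Y^\kappa\to\mathcal M^*$ (the header) and $n\ell$-symbol sequence permutations $\mathcal V=\{\upsilon_w\}_{w\in\mathcal M^*}$, the $\ell$-concatenate-and-permute code has message set $\mathcal M^\ell$, encoder $$m^\ell\mapsto\big[\upsilon_W(F(m_1),\dots,F(m_\ell)),\,G(W)\big],$$ with $W$ uniform on $\mathcal M^*$ and all uses of $F$ and $G$ independent, and decoder $$y^{n\ell+\kappa}\mapsto\big[\theta(b_1),\dots,\theta(b_\ell)\big],$$ where $b_j$ is the $j$-th block of $n$ consecutive symbols of $\upsilon_{\hat w}^{-1}(y_1,\dots,y_{n\ell})$ and $\hat w=\varphi(y_{n\ell+1},\dots,y_{n\ell+\kappa})$. **Theorem.** Let $\lambda>0$, let $n\ge1$,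 $\ell\ge2$, $\kappa\ge0$ be integers, and let $(F,\theta)$ and $(G,\varphi)$ be an $(n,r,\epsilon_f,\delta)$ and a $(\kappa,\psi,\epsilon_g,\infty)$ code, respectively, for WTC-I$(t,u,q)$, where $q$ is the empirical distribution of some sequence in $\mathcal S^{n\ell+\kappa}$ and $$\min_{s\in\mathcal S}q(s)\ \ge\ 4\sqrt{\frac{\ln(n(\ell-1))}{n(\ell-1)}}+\frac{\kappa}{n\ell}.$$ Let $\{\Upsilon_w\}_{w\in\mathcal M^*}$ be $|\mathcal M^*|=2^{\kappa\psi}$ independent random variables, each uniformly distributed over the set of $n\ell$-symbol sequence permutations. Then the probability that the $\ell$-concatenate-and-permute code of $(F,\theta)$ with header $(G,\varphi)$ and permutations $\{\Upsilon_w\}$ is not an $$\Big(n\ell+\kappa,\ r\Big[1-\frac{\kappa}{n\ell+\kappa}\Big],\ \ell\epsilon_f+\epsilon_g,\ \ell\big[\mu e^{\kappa/\ell}\delta+\lambda\big]\Big)$$ code for WTC-II$(t,u,q)$ is strictly less than $$\ell\,|\mathcal S|^{n\ell}\exp\!\Big(-2^{\kappa\psi+1}\Big(\frac{\lambda}{n|\mathcal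 Z|}\Big)^2\Big),\qquad\text{where}\quad \mu=\sqrt2\,e^{-1/4}\,\frac{13}{11}\Big(\frac{2\pi\ell}{\ell-1}\Big)^{|\mathcal S|/2}.$$ -/

import Mathlib

open MeasureTheory ProbabilityTheory
open scoped ENNReal

noncomputable section

namespace Wiretap

theorem tsum_prod_fin {α : Type*} (k : ℕ) (f : Fin k → α → ℝ≥0∞) :
    ∑' x : Fin k → α, ∏ i, f i (x i) = ∏ i, ∑' a, f i a := by
  induction k with
  | zero => simp
  | succ k ih =>
    rw [← (Fin.consEquiv (fun _ : Fin (k + 1) => α)).tsum_eq, Fin.prod_univ_succ,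
      ← ih (fun i => f i.succ), ENNReal.tsum_prod', ← ENNReal.tsum_mul_right]
    refine tsum_congr fun a => ?_
    rw [← ENNReal.tsum_mul_left]
    refine tsum_congr fun x => ?_
    simp [Fin.consEquiv, Fin.prod_univ_succ]

/-- The law of a sequence of `k` independent symbols, the `i`-th with law `p i`:
the sequence `x` has probability `∏ i, p i (x i)`. -/
def seqPMF {k : ℕ} {α : Type*} (p : Fin k → PMF α) : PMF (Fin k → α) :=
  ⟨fun x => ∏ i, p i (x i), by
    have h : ∑' x : Fin k → α, ∏ i, p i (x i) = 1 := by
      rw [tsum_prod_fin k fun i a => p i a]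
      simp [PMF.tsum_coe]
    exact h ▸ ENNReal.summable.hasSum⟩

theorem seqPMF_apply {k : ℕ} {α : Type*} (p : Fin k → PMF α) (x : Fin k → α) :
    seqPMF p x = ∏ i, p i (x i) := rfl

/-- Mutual information, in bits, of a pair `(A, B)` with joint law `p`. -/
def mutualInfo {α β : Type*} [Fintype α] [Fintype β] (p : PMF (α × β)) : ℝ :=
  ∑ a, ∑ b, (p (a, b)).toReal *
    Real.logb 2 ((p (a, b)).toReal /
      ((p.map Prod.fst a).toReal * (p.map Prod.snd b).toReal))

/-- Conditional mutual information `I(A; B | C)`, in bits, of a triple `(A, B, C)` with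
joint law `p`. -/
def condMutualInfo {α β γ : Type*} [Fintype α] [Fintype β] [Fintype γ]
    (p : PMF (α × β × γ)) : ℝ :=
  let pc : γ → ℝ := fun c => (p.map (fun v => v.2.2) c).toReal
  let pac : α → γ → ℝ := fun a c => (p.map (fun v => (v.1, v.2.2)) (a, c)).toReal
  let pbc : β → γ → ℝ := fun b c => (p.map (fun v => (v.2.1, v.2.2)) (b, c)).toReal
  ∑ a, ∑ b, ∑ c, (p (a, b, c)).toReal *
    Real.logb 2 (((p (a, b, c)).toReal / pc c) / ((pac a c / pc c) * (pbc b c / pc c)))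

/-- The type class of `q`: the sequences of length `N` with empirical distribution `q`. -/
def typeClass {S : Type*} (N : ℕ) (q : PMF S) : Set (Fin N → S) :=
  {s | ∀ a, ({i | s i = a}.ncard : ℝ) = N * (q a).toReal}

/-- `q` is an empirical distribution of some sequence of length `N`. -/
def IsType {S : Type*} (N : ℕ) (q : PMF S) : Prop := (typeClass N q).Nonempty

/-- A code of blocklength `n`: a random encoder `M → X ^ n`, given by the law of its output
for each message, and a decoder `Y ^ n → M`. -/
structure Code (X Y M : Type*) (n : ℕ) where
  enc : M → PMF (Fin n → X)
  dec : (Fin n → Y) → M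

variable {X Y Z S M W : Type*} {n : ℕ}

/-- The probability that message `m` is decoded correctly over the memoryless channel `t`. -/
def Code.probCorrect (c : Code X Y M n) (t : X → PMF Y) (m : M) : ℝ :=
  ((((c.enc m).bind fun x => seqPMF fun i => t (x i)).map c.dec) m).toReal

/-- The joint law of `(Z ^ n, M)` for a uniform message `M`, when the eavesdropper's memoryless
channel `u` has the fixed state sequence `s`. -/
def Code.eavesLaw [Fintype M] [Nonempty M] (c : Code X Y M n) (u : X → S → PMF Z)
    (s : Fin n → S) : PMF ((Fin n → Z) × M) :=
  (PMF.uniformOfFintype M).bind fun m =>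
    (c.enc m).bind fun x =>
      (seqPMF fun i => u (x i) (s i)).map fun z => (z, m)

/-- The joint law of `(Z ^ n, M, S ^ n)` when the states are i.i.d. with law `q`, independent
of the message and of the encoder. -/
def Code.eavesLawIID [Fintype M] [Nonempty M] (c : Code X Y M n) (u : X → S → PMF Z)
    (q : PMF S) : PMF ((Fin n → Z) × M × (Fin n → S)) :=
  (seqPMF fun _ => q).bind fun s => (c.eavesLaw u s).map fun v => (v.1, v.2, s)

/-- `c` is an `(n, r, ε, δ)` code for the wiretap channel of type I `(t, u, q)`. -/
structure Code.IsWTCI [Fintype M] [Nonempty M] [Fintype S] [Fintype Z]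
    (c : Code X Y M n) (t : X → PMF Y) (u : X → S → PMF Z) (q : PMF S)
    (r ε : ℝ) (δ : EReal) : Prop where
  rate : (Fintype.card M : ℝ) = (2 : ℝ) ^ ((n : ℝ) * r)
  error : 1 - ε ≤ (Fintype.card M : ℝ)⁻¹ * ∑ m, c.probCorrect t m
  secrecy : (condMutualInfo (c.eavesLawIID u q) : EReal) ≤ δ

/-- `c` is an `(n, r, ε, δ)` code for the wiretap channel of type II `(t, u, q)`. -/
structure Code.IsWTCII [Fintype M] [Nonempty M] [Fintype Z]
    (c : Code X Y M n) (t : X → PMF Y) (u : X → S → PMF Z) (q : PMF S)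
    (r ε : ℝ) (δ : EReal) : Prop where
  rate : (Fintype.card M : ℝ) = (2 : ℝ) ^ ((n : ℝ) * r)
  error : 1 - ε ≤ (Fintype.card M : ℝ)⁻¹ * ∑ m, c.probCorrect t m
  secrecy : ∀ s ∈ typeClass n q, (mutualInfo (c.eavesLaw u s) : EReal) ≤ δ

/-- The sequence permutation given by `σ`: `(x_1, x_2, …) ↦ (x_{σ 1}, x_{σ 2}, …)`. -/
def permute {N : ℕ} {A : Type*} (σ : Equiv.Perm (Fin N)) (x : Fin N → A) : Fin N → A :=
  fun i => x (σ i)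

/-- Concatenation of `l` blocks of length `n`. -/
def concat {l n : ℕ} {A : Type*} (x : Fin l → Fin n → A) : Fin (l * n) → A :=
  fun i => x (finProdFinEquiv.symm i).1 (finProdFinEquiv.symm i).2

/-- The `j`-th block of length `n`: the symbols at the (zero-based) positions
`n * j, …, n * j + n - 1`. -/
def block {l n : ℕ} {A : Type*} (x : Fin (l * n) → A) (j : Fin l) : Fin n → A :=
  fun i => x (finProdFinEquiv (j, i))

/-- The `l`-concatenate and permute code of `c` with header `h` and permutations `V`. -/
def concatPermute {κ : ℕ} [Fintype W] [Nonempty W] (l : ℕ) (c : Code X Y M n)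
    (h : Code X Y W κ) (V : W → Equiv.Perm (Fin (l * n))) :
    Code X Y (Fin l → M) (l * n + κ) where
  enc m :=
    (seqPMF fun j => c.enc (m j)).bind fun x =>
      (PMF.uniformOfFintype W).bind fun w =>
        (h.enc w).map fun g => Fin.append (permute (V w) (concat x)) g
  dec y :=
    let w := h.dec fun i => y (Fin.natAdd (l * n) i)
    let y' := permute (V w)⁻¹ fun i => y (Fin.castAdd κ i)
    fun j => c.dec (block y' j)

/-- The constant `μ = √2 e^{-1/4} (13/11) (2 π l / (l - 1))^{k/2}`, `k` the number of states. -/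
def mu (l k : ℕ) : ℝ :=
  √2 * Real.exp (-(1 / 4)) * (13 / 11) *
    (2 * Real.pi * (l : ℝ) / ((l : ℝ) - 1)) ^ ((k : ℝ) / 2)

instance permMeasurableSpace (N : ℕ) : MeasurableSpace (Equiv.Perm (Fin N)) := ⊤

end Wiretap

end

/-!
Conditionally on the index `w` carried by the header, the eavesdropper of the concatenate-and-permute
code sees the `l` blocks through independent channels, the block `j` being affected by the `j`-th
block of the unpermuted state sequence `υ_w⁻¹ s`. Revealing `w` to the eavesdropper only helps, and
the header carries no further information on the messages, so by the log-sum inequality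
(`chanInfo_mixture_le`) and additivity over independent blocks (`chanInfo_seqPMF`) the leakage is at
most `∑ j, |W|⁻¹ ∑ w, f (block j of υ_w⁻¹ s)`, where `f v` is the leakage of the inner code under the
state sequence `v` (`mutualInfo_concatPermute_le`).

For a uniformly random permutation a block of the permuted states is a sample without replacement
from the first `l * n` states. Such a sample is dominated by an i.i.d. sample: every word `v` has
probability at most `mu * exp (κ / l) * ∏ i, q (v i)` (`card_perm_pattern_le_mu`). The factor
`exp (κ / l)` accounts for the letters of the type class used up by the header. For the rest, put
`ρ = l / (l - 1)`, the ratio of the population sizes before and after sampling. The number of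
ordered samples is a product of falling factorials, one for each letter, and by Stirling's formula
and the bound `O(1 / √A)` on the point probabilities of a Poisson variable (`sqrt_mul_pow_le`) each
of them costs at most a factor `√(2πρ)` (`descFactorial_le`); the remaining ratio of factorials is
absorbed by the prefactor of `mu` (`factorial_mul_pow_le`). Hence the mean of `f` over the random
block is at most `mu * exp (κ / l)` times its mean under i.i.d. states, which is the conditional
mutual information bounded by `δ` (`condMutualInfo_eavesLawIID`).

As `0 ≤ f ≤ n * logb 2 |Z|`, Hoeffding's inequality over the independent permutations shows that
the average over `w` exceeds this mean by `lam` with exponentially small probability, and a union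
bound over the blocks and over the first `l * n` states concludes. The rate and the error
probability (`concatPermute_error`) are as required for every choice of the permutations.
-/

noncomputable section

namespace Wiretap

/-! ### Product laws and the concatenate-and-permute code -/

theorem seqPMF_bind {k : ℕ} {α β : Type*} (p : Fin k → PMF α) (f : Fin k → α → PMF β) :
    ((seqPMF p).bind fun x => seqPMF fun i => f i (x i)) = seqPMF fun i => (p i).bind (f i) := by
  ext y
  simp only [PMF.bind_apply, seqPMF_apply, ← Finset.prod_mul_distrib]
  exact tsum_prod_fin k fun i a => p i a * f i a (y i)

theorem seqPMF_pure {k : ℕ} {α : Type*} (a : Fin k → α) :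
    (seqPMF fun i => PMF.pure (a i)) = PMF.pure a := by
  classical
  ext y
  simp only [seqPMF_apply, PMF.pure_apply, Finset.prod_ite_zero, Finset.prod_const_one,
    funext_iff, Finset.mem_univ, true_imp_iff]

theorem seqPMF_map {k : ℕ} {α β : Type*} (p : Fin k → PMF α) (f : Fin k → α → β) :
    ((seqPMF p).map fun x i => f i (x i)) = seqPMF fun i => (p i).map (f i) := by
  have := seqPMF_bind p fun i a => PMF.pure (f i a)
  simp only [seqPMF_pure] at this
  exact this

theorem map_apply_of_injective {α β : Type*} (p : PMF α) {f : α → β}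
    (hf : Function.Injective f) (a : α) : p.map f (f a) = p a := by
  classical
  rw [PMF.map_apply, tsum_eq_single a]
  · simp
  · intro b hb
    rw [if_neg]
    exact fun h => hb (hf h).symm

theorem map_equiv_apply {α β : Type*} (p : PMF α) (e : α ≃ β) (b : β) :
    p.map e b = p (e.symm b) := by
  simpa only [Equiv.apply_symm_apply] using map_apply_of_injective p e.injective (e.symm b)

/-- Concatenation of blocks as a bijection, with inverse the splitting into blocks. -/
def concatEquiv (l n : ℕ) (A : Type*) : (Fin l → Fin n → A) ≃ (Fin (l * n) → A) where
  toFun := concat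
  invFun := block
  left_inv x := by ext j i; simp [concat, block]
  right_inv x := by ext i; exact congrArg x (finProdFinEquiv.right_inv i)

/-- A sequence permutation as a bijection of the set of sequences. -/
def permuteEquiv {N : ℕ} (σ : Equiv.Perm (Fin N)) (A : Type*) : (Fin N → A) ≃ (Fin N → A) where
  toFun := permute σ
  invFun := permute σ⁻¹
  left_inv x := by ext i; simp [permute]
  right_inv x := by ext i; simp [permute]

theorem seqPMF_map_concat {l n : ℕ} {α : Type*} (p : Fin (l * n) → PMF α) :
    (seqPMF fun j => seqPMF (block p j)).map concat = seqPMF p := by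
  ext y
  refine (map_equiv_apply _ (concatEquiv l n α) y).trans ?_
  simp only [seqPMF_apply, concatEquiv, Equiv.coe_fn_symm_mk, block]
  rw [← Fintype.prod_prod_type', ← finProdFinEquiv.prod_comp]

theorem seqPMF_map_permute {N : ℕ} {α : Type*} (p : Fin N → PMF α) (σ : Equiv.Perm (Fin N)) :
    (seqPMF p).map (permute σ) = seqPMF (permute σ p) := by
  ext y
  refine (map_equiv_apply _ (permuteEquiv σ α) y).trans ?_
  simp only [seqPMF_apply, permuteEquiv, Equiv.coe_fn_symm_mk]
  exact (Equiv.prod_comp σ fun i => p i (y (σ⁻¹ i))).symm.trans (by simp [permute])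

theorem seqPMF_append {a b : ℕ} {α : Type*} (p : Fin (a + b) → PMF α) :
    seqPMF p = (seqPMF fun i => p (Fin.castAdd b i)).bind fun x =>
      (seqPMF fun i => p (Fin.natAdd a i)).map fun y => Fin.append x y := by
  classical
  ext z
  simp only [PMF.bind_apply, PMF.map_apply]
  rw [tsum_eq_single fun i => z (Fin.castAdd b i), tsum_eq_single fun i => z (Fin.natAdd a i)]
  · rw [if_pos (Fin.append_castAdd_natAdd (f := z)).symm]
    simp [seqPMF_apply, Fin.prod_univ_add]
  · intro y hy
    rw [if_neg]
    intro h
    exact hy (by ext i; rw [h]; simp)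
  · intro x hx
    refine mul_eq_zero_of_right _ (ENNReal.tsum_eq_zero.2 fun y => ?_)
    rw [if_neg]
    rintro rfl
    exact hx (by ext i; simp)

section Code

variable {X Y B M W : Type*} {n : ℕ}

/-- The law of the output of a memoryless, possibly time-varying, channel `v` when message `m`
is encoded by `c`. -/
def Code.outLaw (c : Code X Y M n) (v : Fin n → X → PMF B) (m : M) : PMF (Fin n → B) :=
  (c.enc m).bind fun x => seqPMF fun i => v i (x i)

/-- For a fixed sequence permutation, permuting the codeword and then sending it through a
memoryless channel amounts to sending the blocks through the unpermuted channel and permuting the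
output. -/
theorem bind_permute_concat {l n : ℕ} (p : Fin l → PMF (Fin n → X)) (σ : Equiv.Perm (Fin (l * n)))
    (v : Fin (l * n) → X → PMF B) :
    ((seqPMF p).bind fun x => seqPMF fun i => v i (permute σ (concat x) i)) =
      (seqPMF fun j => (p j).bind fun x => seqPMF fun i => block (permute σ⁻¹ v) j i (x i)).map
        fun z => permute σ (concat z) := by
  rw [← seqPMF_bind p fun j x => seqPMF fun i => block (permute σ⁻¹ v) j i (x i), PMF.map_bind]
  congr 1
  ext1 x
  have h1 := seqPMF_map_concat (l := l) (n := n) fun i => permute σ⁻¹ v i (concat x i)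
  have h2 := seqPMF_map_permute (fun i => permute σ⁻¹ v i (concat x i)) σ
  rw [← h1, PMF.map_comp] at h2
  rw [show (fun i => v i (permute σ (concat x) i)) =
    permute σ fun i => permute σ⁻¹ v i (concat x i) by ext1 i; simp [permute], ← h2]
  congr 2
  ext1 j
  congr 1
  ext1 i
  simp [block, concat]

/-- The output law of the concatenate-and-permute code: conditionally on the index `w`, the header
and the permuted blocks are received independently, and so are the individual blocks. -/
theorem concatPermute_outLaw {κ : ℕ} [Fintype W] [Nonempty W] (l : ℕ) (c : Code X Y M n)
    (h : Code X Y W κ) (V : W → Equiv.Perm (Fin (l * n))) (v : Fin (l * n + κ) → X → PMF B)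
    (m : Fin l → M) :
    (concatPermute l c h V).outLaw v m =
      (PMF.uniformOfFintype W).bind fun w =>
        (seqPMF fun j =>
          c.outLaw (block (permute (V w)⁻¹ fun i => v (Fin.castAdd κ i)) j) (m j)).bind fun z =>
        (h.outLaw (fun i => v (Fin.natAdd (l * n) i)) w).map fun g =>
          Fin.append (permute (V w) (concat z)) g := by
  simp only [Code.outLaw, concatPermute, PMF.bind_bind]
  rw [PMF.bind_comm]
  congr 1
  ext1 w
  have key := congrArg (fun p => PMF.bind p fun z => ((h.enc w).bind fun x =>
    seqPMF fun i => v (Fin.natAdd (l * n) i) (x i)).map fun g => Fin.append z g)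
    (bind_permute_concat (fun j => c.enc (m j)) (V w) fun i => v (Fin.castAdd κ i))
  simp only [PMF.bind_map, PMF.bind_bind, Function.comp_def] at key
  refine Eq.trans ?_ key
  congr 1
  ext1 x
  rw [PMF.bind_map]
  simp only [PMF.map_bind]
  rw [PMF.bind_comm]
  congr 1
  ext1 g
  simp only [Function.comp_def]
  rw [seqPMF_append]
  simp

/-- The probability of correct decoding of a fixed message sequence is at least the average over
`w` of the probability that the header and all blocks are decoded correctly. -/
theorem concatPermute_probCorrect_ge {κ : ℕ} [Fintype W] [Nonempty W] (l : ℕ) (c : Code X Y M n)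
    (h : Code X Y W κ) (V : W → Equiv.Perm (Fin (l * n))) (t : X → PMF Y) (m : Fin l → M) :
    ((Fintype.card W : ℝ)⁻¹ * ∑ w, h.probCorrect t w) * ∏ j, c.probCorrect t (m j) ≤
      (concatPermute l c h V).probCorrect t m := by
  classical
  have main : (∑ w, (Fintype.card W : ℝ≥0∞)⁻¹ * (((h.outLaw (fun _ => t) w).map h.dec) w *
      ∏ j, ((c.outLaw (fun _ => t) (m j)).map c.dec) (m j))) ≤
      (((concatPermute l c h V).outLaw (fun _ => t) m).map (concatPermute l c h V).dec) m := by
    rw [concatPermute_outLaw, PMF.map_bind, PMF.bind_apply, tsum_fintype]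
    refine Finset.sum_le_sum fun w _ => ?_
    rw [PMF.uniformOfFintype_apply]
    refine mul_le_mul_right ?_ _
    have hb : ∀ j : Fin l, (block (permute (V w)⁻¹ fun _ : Fin (l * n) => t) j) = fun _ => t :=
      fun j => rfl
    simp only [hb]
    rw [← seqPMF_apply (fun j => (c.outLaw (fun _ => t) (m j)).map c.dec) m, ← seqPMF_map,
      PMF.map_bind, PMF.bind_apply, PMF.map_apply (fun (x : Fin l → Fin n → Y) j => c.dec (x j)),
      mul_comm, ← ENNReal.tsum_mul_right]
    refine ENNReal.tsum_le_tsum fun z => ?_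
    split_ifs with hz
    swap
    · simp
    refine mul_le_mul_right ?_ _
    rw [PMF.map_comp, PMF.map_apply, PMF.map_apply]
    refine ENNReal.tsum_le_tsum fun g => ?_
    split_ifs with h1 h2 h2
    · exact le_rfl
    · refine absurd ?_ h2
      rw [hz]
      ext1 j
      simp only [concatPermute, Function.comp_apply, Fin.append_right, Fin.append_left, ← h1]
      congr 1
      ext1 i
      simp [block, permute, concat]
    · exact zero_le
    · exact le_rfl
  have := ENNReal.toReal_mono (PMF.apply_ne_top _ _) main
  refine le_trans (le_of_eq ?_) this
  rw [ENNReal.toReal_sum]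
  · simp only [ENNReal.toReal_mul, ENNReal.toReal_prod, ENNReal.toReal_inv, ENNReal.toReal_natCast]
    rw [Finset.mul_sum, Finset.sum_mul]
    exact Finset.sum_congr rfl fun w _ => mul_assoc _ _ _
  · intro w _
    refine ENNReal.mul_ne_top (by simp) (ENNReal.mul_ne_top (PMF.apply_ne_top _ _) ?_)
    exact ENNReal.prod_ne_top fun j _ => PMF.apply_ne_top _ _

theorem probCorrect_mem_Icc (c : Code X Y M n) (t : X → PMF Y) (m : M) :
    c.probCorrect t m ∈ Set.Icc 0 1 :=
  ⟨ENNReal.toReal_nonneg, ENNReal.toReal_le_of_le_ofReal zero_le_one (by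
    rw [ENNReal.ofReal_one]; exact PMF.coe_le_one _ _)⟩

/-- A union bound: `a * b ^ l ≥ 1 - (1 - a) - l * (1 - b)` for `a, b ∈ [0, 1]`. -/
theorem union_bound_mul_pow {a b x y : ℝ} (l : ℕ) (ha1 : a ≤ 1) (hb0 : 0 ≤ b)
    (hb1 : b ≤ 1) (hx : 1 - x ≤ a) (hy : 1 - y ≤ b) : 1 - (l * y + x) ≤ a * b ^ l := by
  have h1 : 1 - (l : ℝ) * (1 - b) ≤ b ^ l := by
    have := one_add_mul_le_pow (show (-2 : ℝ) ≤ b - 1 by linarith) l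
    rw [add_sub_cancel] at this
    linarith
  have h2 : b ^ l ≤ 1 := pow_le_one₀ hb0 hb1
  have h3 : (l : ℝ) * (1 - b) ≤ l * y := by gcongr; linarith
  nlinarith

theorem average_mem_Icc {ι : Type*} [Fintype ι] [Nonempty ι] {f : ι → ℝ}
    (hf : ∀ i, f i ∈ Set.Icc (0 : ℝ) 1) :
    (Fintype.card ι : ℝ)⁻¹ * ∑ i, f i ∈ Set.Icc (0 : ℝ) 1 := by
  have hc : (0 : ℝ) < Fintype.card ι := by exact_mod_cast Fintype.card_pos
  refine ⟨mul_nonneg (by positivity) (Finset.sum_nonneg fun i _ => (hf i).1), ?_⟩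
  rw [inv_mul_le_iff₀ hc, mul_one]
  calc ∑ i, f i ≤ ∑ _i : ι, (1 : ℝ) := Finset.sum_le_sum fun i _ => (hf i).2
    _ = _ := by simp

/-- The average error probability of the concatenate-and-permute code is at most
`l * εf + εg`, for every choice of the permutations. -/
theorem concatPermute_error {κ : ℕ} [Fintype M] [Nonempty M] [Fintype W] [Nonempty W] (l : ℕ)
    (c : Code X Y M n) (h : Code X Y W κ) (V : W → Equiv.Perm (Fin (l * n))) (t : X → PMF Y)
    {εf εg : ℝ} (hc : 1 - εf ≤ (Fintype.card M : ℝ)⁻¹ * ∑ m, c.probCorrect t m)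
    (hh : 1 - εg ≤ (Fintype.card W : ℝ)⁻¹ * ∑ w, h.probCorrect t w) :
    1 - (l * εf + εg) ≤ (Fintype.card (Fin l → M) : ℝ)⁻¹ *
      ∑ m, (concatPermute l c h V).probCorrect t m := by
  obtain ⟨-, a1⟩ := average_mem_Icc fun w => probCorrect_mem_Icc h t w
  obtain ⟨b0, b1⟩ := average_mem_Icc fun m => probCorrect_mem_Icc c t m
  refine (union_bound_mul_pow l a1 b0 b1 hh hc).trans ?_
  calc _ = (Fintype.card (Fin l → M) : ℝ)⁻¹ * ∑ m : Fin l → M,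
        ((Fintype.card W : ℝ)⁻¹ * ∑ w, h.probCorrect t w) * ∏ j, c.probCorrect t (m j) := by
        rw [← Finset.mul_sum, mul_left_comm, ← Fintype.sum_pow, mul_pow, Fintype.card_fun]
        simp
    _ ≤ _ := by
        gcongr with m
        exact concatPermute_probCorrect_ge l c h V t m

end Code

/-! ### Mutual information between a uniform message and the output of a channel -/

/-- The **log-sum inequality**. -/
theorem log_sum_inequality {ι : Type*} [Fintype ι] (a b : ι → ℝ) (ha : ∀ i, 0 ≤ a i)
    (hb : ∀ i, 0 ≤ b i) (hab : ∀ i, b i = 0 → a i = 0) :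
    (∑ i, a i) * Real.logb 2 ((∑ i, a i) / ∑ i, b i) ≤ ∑ i, a i * Real.logb 2 (a i / b i) := by
  have h2 : (0 : ℝ) < Real.log 2 := Real.log_pos one_lt_two
  simp only [Real.logb, ← mul_div_assoc, ← Finset.sum_div]
  refine div_le_div_of_nonneg_right ?_ h2.le
  set A := ∑ i, a i with hA
  set B := ∑ i, b i with hB
  rcases (Finset.sum_nonneg fun i _ => ha i : 0 ≤ A).eq_or_lt with h0 | hApos
  · have h0' := (Finset.sum_eq_zero_iff_of_nonneg fun i _ => ha i).1 (hA.symm.trans h0.symm)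
    rw [show A = 0 from h0.symm, zero_mul]
    refine le_of_eq (Finset.sum_eq_zero fun i hi => ?_).symm
    rw [h0' i hi, zero_mul]
  have hBpos : 0 < B := by
    refine (Finset.sum_nonneg fun i _ => hb i : 0 ≤ B).lt_of_ne fun h0 => hApos.ne' ?_
    have h0' := (Finset.sum_eq_zero_iff_of_nonneg fun i _ => hb i).1 (hB.symm.trans h0.symm)
    exact Finset.sum_eq_zero fun i hi => hab i (h0' i hi)
  -- termwise, `log x ≥ 1 - x⁻¹` at `x = (a i / b i) / (A / B)`
  have key : ∀ i, a i * Real.log (A / B) + (a i - b i * (A / B)) ≤ a i * Real.log (a i / b i) := by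
    intro i
    rcases (ha i).eq_or_lt with h0 | hai
    · have : 0 ≤ b i * (A / B) := mul_nonneg (hb i) (div_pos hApos hBpos).le
      rw [← h0]
      simpa using this
    have hbi : 0 < b i := (hb i).lt_of_ne fun h => hai.ne' (hab i h.symm)
    have hx : 0 < (a i / b i) / (A / B) := by positivity
    have h1 := Real.one_sub_inv_le_log_of_pos hx
    rw [Real.log_div (by positivity) (by positivity)] at h1
    have h3 := mul_le_mul_of_nonneg_left h1 hai.le
    have h4 : a i * (1 - ((a i / b i) / (A / B))⁻¹) = a i - b i * (A / B) := by
      field_simp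
    rw [h4] at h3
    linarith
  have hs := Finset.sum_le_sum fun i (_ : i ∈ Finset.univ) => key i
  rw [Finset.sum_add_distrib, ← Finset.sum_mul, Finset.sum_sub_distrib, ← Finset.sum_mul, ← hA,
    ← hB, mul_div_cancel₀ _ hBpos.ne', sub_self, add_zero] at hs
  exact hs

theorem sum_toReal_eq_one {A : Type*} [Fintype A] (p : PMF A) : ∑ a, (p a).toReal = 1 := by
  rw [← ENNReal.toReal_sum fun a _ => PMF.apply_ne_top _ _, ← tsum_fintype (L := .unconditional _),
    PMF.tsum_coe]
  rfl

theorem bind_uniform_toReal {W B : Type*} [Fintype W] [Nonempty W] (f : W → PMF B) (b : B) :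
    (((PMF.uniformOfFintype W).bind f) b).toReal =
      (Fintype.card W : ℝ)⁻¹ * ∑ w, (f w b).toReal := by
  rw [PMF.bind_apply, tsum_fintype, ENNReal.toReal_sum, Finset.mul_sum]
  · simp
  · intro w _
    exact ENNReal.mul_ne_top (PMF.apply_ne_top _ _) (PMF.apply_ne_top _ _)

/-- The joint law of channel output and channel input, when the input has law `P`. -/
theorem bind_map_prodMk_apply {M A : Type*} (P : PMF M) (K : M → PMF A) (a : A) (m : M) :
    (P.bind fun m => (K m).map fun a => (a, m)) (a, m) = P m * K m a := by
  classical
  rw [PMF.bind_apply, tsum_eq_single m]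
  · rw [PMF.map_apply, tsum_eq_single a]
    · simp
    · intro b hb
      simp [hb.symm]
  · intro m' hm'
    rw [PMF.map_apply]
    simp [hm'.symm]

section Information

variable {M A B W : Type*} [Fintype M] [Nonempty M]

/-- The law of the output of the channel `K` under a uniform input. -/
def outAvg (K : M → PMF A) (a : A) : ℝ := (Fintype.card M : ℝ)⁻¹ * ∑ m, (K m a).toReal

theorem outAvg_nonneg (K : M → PMF A) (a : A) : 0 ≤ outAvg K a := by
  unfold outAvg
  positivity

theorem eq_zero_of_outAvg_eq_zero {K : M → PMF A} {a : A} (h : outAvg K a = 0) (m : M) :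
    (K m a).toReal = 0 := by
  have hM : (Fintype.card M : ℝ) ≠ 0 := by exact_mod_cast Fintype.card_ne_zero
  have := (mul_eq_zero.1 h).resolve_left (inv_ne_zero hM)
  exact (Finset.sum_eq_zero_iff_of_nonneg fun _ _ => ENNReal.toReal_nonneg).1 this m
    (Finset.mem_univ m)

variable [Fintype A] [Fintype B]

/-- Mutual information, in bits, between the output of the channel `K` and a uniform input. -/
def chanInfo (K : M → PMF A) : ℝ :=
  mutualInfo ((PMF.uniformOfFintype M).bind fun m => (K m).map fun a => (a, m))

theorem chanInfo_eq (K : M → PMF A) :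
    chanInfo K = ∑ a, ∑ m, (Fintype.card M : ℝ)⁻¹ *
      ((K m a).toReal * Real.logb 2 ((K m a).toReal / outAvg K a)) := by
  have hM : (Fintype.card M : ℝ) ≠ 0 := by exact_mod_cast Fintype.card_ne_zero
  refine Finset.sum_congr rfl fun a _ => Finset.sum_congr rfl fun m _ => ?_
  have h1 : ((PMF.uniformOfFintype M).bind fun m => (K m).map fun a => (a, m)).map Prod.fst =
      (PMF.uniformOfFintype M).bind K := by
    simp only [PMF.map_bind, PMF.map_comp, Function.comp_def]
    exact congrArg _ (funext fun m => PMF.map_id _)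
  have h2 : ((PMF.uniformOfFintype M).bind fun m => (K m).map fun a => (a, m)).map Prod.snd =
      PMF.uniformOfFintype M := by
    simp only [PMF.map_bind, PMF.map_comp, Function.comp_def]
    exact (congrArg _ (funext fun m => PMF.map_const _ m)).trans (PMF.bind_pure _)
  rw [h1, h2, bind_map_prodMk_apply, bind_uniform_toReal]
  simp only [outAvg, ENNReal.toReal_mul, PMF.uniformOfFintype_apply, ENNReal.toReal_inv,
    ENNReal.toReal_natCast]
  rw [mul_comm _ (Fintype.card M : ℝ)⁻¹, mul_div_mul_left _ _ (inv_ne_zero hM), mul_assoc]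

theorem sum_outAvg (K : M → PMF A) : ∑ a, outAvg K a = 1 := by
  have hM : (Fintype.card M : ℝ) ≠ 0 := by exact_mod_cast Fintype.card_ne_zero
  simp only [outAvg, ← Finset.mul_sum]
  rw [Finset.sum_comm]
  simp [sum_toReal_eq_one, hM]

theorem chanInfo_nonneg (K : M → PMF A) : 0 ≤ chanInfo K := by
  rw [chanInfo_eq, Finset.sum_comm]
  refine Finset.sum_nonneg fun m _ => ?_
  rw [← Finset.mul_sum]
  refine mul_nonneg (by positivity) ?_
  have := log_sum_inequality (fun a => (K m a).toReal) (outAvg K) (fun _ => ENNReal.toReal_nonneg)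
    (outAvg_nonneg K) fun a h => eq_zero_of_outAvg_eq_zero h m
  simpa [sum_toReal_eq_one, sum_outAvg] using this

theorem chanInfo_le (K : M → PMF A) : chanInfo K ≤ Real.logb 2 (Fintype.card A) := by
  have key : chanInfo K ≤ ∑ a, -(outAvg K a * Real.logb 2 (outAvg K a / 1)) := by
    rw [chanInfo_eq]
    refine Finset.sum_le_sum fun a _ => ?_
    rw [← mul_neg, div_one, ← Real.logb_inv]
    conv_rhs => rw [outAvg, mul_assoc, Finset.sum_mul, Finset.mul_sum]
    refine Finset.sum_le_sum fun m _ => ?_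
    refine mul_le_mul_of_nonneg_left ?_ (by positivity)
    rcases (ENNReal.toReal_nonneg : 0 ≤ (K m a).toReal).eq_or_lt with h0 | hpos
    · rw [← h0]; simp
    have havg : 0 < outAvg K a := (outAvg_nonneg K a).lt_of_ne fun h =>
      hpos.ne' (eq_zero_of_outAvg_eq_zero h.symm m)
    refine mul_le_mul_of_nonneg_left ?_ hpos.le
    refine Real.logb_le_logb_of_le one_lt_two (by positivity) ?_
    rw [div_eq_mul_inv]
    refine mul_le_of_le_one_left (by positivity) ?_
    exact ENNReal.toReal_le_of_le_ofReal zero_le_one (by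
      rw [ENNReal.ofReal_one]; exact PMF.coe_le_one _ _)
  have := log_sum_inequality (outAvg K) (fun _ => 1) (outAvg_nonneg K) (fun _ => zero_le_one)
    (by simp)
  rw [sum_outAvg, one_mul, Finset.sum_const, Finset.card_univ, nsmul_one, one_div,
    Real.logb_inv] at this
  rw [Finset.sum_neg_distrib] at key
  linarith

theorem chanInfo_map_equiv (K : M → PMF A) (e : A ≃ B) :
    chanInfo (fun m => (K m).map e) = chanInfo K := by
  rw [chanInfo_eq, chanInfo_eq, ← e.sum_comp]
  simp only [outAvg, map_equiv_apply, Equiv.symm_apply_apply]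

/-- Mutual information is additive over independent uses of channels. -/
theorem chanInfo_seqPMF {l : ℕ} (K : Fin l → M → PMF A) :
    chanInfo (fun m : Fin l → M => seqPMF fun j => K j (m j)) = ∑ j, chanInfo (K j) := by
  have hM : (Fintype.card M : ℝ) ≠ 0 := by exact_mod_cast Fintype.card_ne_zero
  set w : Fin l → A × M → ℝ := fun j p => (Fintype.card M : ℝ)⁻¹ * (K j p.2 p.1).toReal with hw
  set L : Fin l → A × M → ℝ := fun j p => Real.logb 2 ((K j p.2 p.1).toReal / outAvg (K j) p.1)
    with hL
  have hinfo : ∀ j, chanInfo (K j) = ∑ p, w j p * L j p := by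
    intro j
    rw [chanInfo_eq, Fintype.sum_prod_type]
    simp [hw, hL, mul_assoc]
  have hw1 : ∀ j, ∑ p, w j p = 1 := by
    intro j
    rw [Fintype.sum_prod_type, Finset.sum_comm]
    simp [hw, ← Finset.mul_sum, sum_toReal_eq_one, hM]
  have havg : ∀ a : Fin l → A, outAvg (fun m : Fin l → M => seqPMF fun j => K j (m j)) a =
      ∏ j, outAvg (K j) (a j) := by
    intro a
    simp only [outAvg, seqPMF_apply, ENNReal.toReal_prod]
    rw [Finset.prod_mul_distrib, Finset.prod_univ_sum, Fintype.piFinset_univ]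
    simp
  have hterm : ∀ p : Fin l → A × M,
      (Fintype.card (Fin l → M) : ℝ)⁻¹ * ((∏ j, (K j (p j).2 (p j).1).toReal) *
        Real.logb 2 ((∏ j, (K j (p j).2 (p j).1).toReal) / ∏ j, outAvg (K j) (p j).1)) =
      ∑ i, (∏ j, w j (p j)) * L i (p i) := by
    intro p
    have hc : (Fintype.card (Fin l → M) : ℝ)⁻¹ = ∏ _j : Fin l, (Fintype.card M : ℝ)⁻¹ := by simp
    rw [← Finset.mul_sum, hw, hc, Finset.prod_mul_distrib, ← mul_assoc]
    by_cases h0 : ∀ j, (K j (p j).2 (p j).1).toReal ≠ 0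
    · rw [← Finset.prod_div_distrib, Real.logb_prod]
      intro j _
      exact div_ne_zero (h0 j) fun h => h0 j (eq_zero_of_outAvg_eq_zero h _)
    · push Not at h0
      obtain ⟨j, hj⟩ := h0
      rw [Finset.prod_eq_zero (f := fun j => (K j (p j).2 (p j).1).toReal) (Finset.mem_univ j) hj]
      simp
  rw [chanInfo_eq, ← Fintype.sum_prod_type', ← (Equiv.arrowProdEquivProdArrow _ _ _).sum_comp]
  simp only [havg, seqPMF_apply, ENNReal.toReal_prod, Equiv.arrowProdEquivProdArrow_apply]
  rw [Finset.sum_congr rfl fun p _ => hterm p, Finset.sum_comm]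
  refine Finset.sum_congr rfl fun i _ => ?_
  -- all factors other than the `i`-th sum to one
  have hprod : ∀ p : Fin l → A × M, (∏ j, w j (p j)) * L i (p i) =
      ∏ j, (w j (p j) * if j = i then L j (p j) else 1) := by
    intro p
    calc _ = (∏ j, w j (p j)) * ∏ j, (if j = i then L j (p j) else 1) := by simp
      _ = _ := Finset.prod_mul_distrib.symm
  rw [Finset.sum_congr rfl fun p _ => hprod p, hinfo, ← Fintype.piFinset_univ,
    ← Finset.prod_univ_sum (fun _ => Finset.univ)
      (fun j (q : A × M) => w j q * if j = i then L j q else 1)]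
  rw [Finset.prod_eq_single i]
  · simp
  · intro j _ hj
    simp [hj, hw1]
  · simp

/-- If an index `w`, uniform and independent of the message, selects the channel `A' w`, and the
receiver also observes a signal `H w` that depends on `w` alone, then the information received is
at most the average over `w` of the information conveyed by `A' w`. -/
theorem chanInfo_mixture_le [Fintype W] [Nonempty W] (A' : W → M → PMF A) (H : W → PMF B) :
    chanInfo (fun m => (PMF.uniformOfFintype W).bind fun w =>
      (A' w m).bind fun z => (H w).map fun g => (z, g)) ≤
      (Fintype.card W : ℝ)⁻¹ * ∑ w, chanInfo (A' w) := by
  classical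
  have hW : (Fintype.card W : ℝ) ≠ 0 := by exact_mod_cast Fintype.card_ne_zero
  set K : M → PMF (A × B) := fun m => (PMF.uniformOfFintype W).bind fun w =>
      (A' w m).bind fun z => (H w).map fun g => (z, g) with hK
  have hpair : ∀ w m z g, ((A' w m).bind fun z => (H w).map fun g => (z, g)) (z, g) =
      A' w m z * H w g := by
    intro w m z g
    rw [PMF.bind_apply, tsum_eq_single z]
    · rw [PMF.map_apply, tsum_eq_single g]
      · simp
      · intro b hb
        simp [hb.symm]
    · intro z' hz'
      rw [PMF.map_apply]
      simp [hz'.symm]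
  have hKa : ∀ m z g, (K m (z, g)).toReal =
      ∑ w, (Fintype.card W : ℝ)⁻¹ * ((A' w m z).toReal * (H w g).toReal) := by
    intro m z g
    rw [hK, bind_uniform_toReal, Finset.mul_sum]
    simp [hpair]
  have havg : ∀ z g, outAvg K (z, g) =
      ∑ w, (Fintype.card W : ℝ)⁻¹ * (outAvg (A' w) z * (H w g).toReal) := by
    intro z g
    simp only [outAvg, hKa]
    rw [Finset.sum_comm, Finset.mul_sum]
    refine Finset.sum_congr rfl fun w _ => ?_
    rw [← Finset.mul_sum, ← Finset.sum_mul]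
    ring
  have hls : ∀ m z g, (K m (z, g)).toReal * Real.logb 2 ((K m (z, g)).toReal / outAvg K (z, g)) ≤
      ∑ w, (Fintype.card W : ℝ)⁻¹ * ((A' w m z).toReal * (H w g).toReal) *
        Real.logb 2 ((A' w m z).toReal / outAvg (A' w) z) := by
    intro m z g
    rw [havg, hKa]
    refine (log_sum_inequality _ _ (fun w => by positivity) (fun w => ?_) (fun w h => ?_)).trans
      (Finset.sum_le_sum fun w _ => le_of_eq ?_)
    · have := outAvg_nonneg (A' w) z
      positivity
    · rcases mul_eq_zero.1 ((mul_eq_zero.1 h).resolve_left (inv_ne_zero hW)) with h | h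
      · simp [eq_zero_of_outAvg_eq_zero h m]
      · simp [h]
    · by_cases h0 : (H w g).toReal = 0
      · simp [h0]
      · rw [mul_div_mul_left _ _ (inv_ne_zero hW), mul_div_mul_right _ _ h0]
  rw [chanInfo_eq, Fintype.sum_prod_type]
  calc _ ≤ ∑ z, ∑ g, ∑ m, (Fintype.card M : ℝ)⁻¹ *
        ∑ w, (Fintype.card W : ℝ)⁻¹ * ((A' w m z).toReal * (H w g).toReal) *
          Real.logb 2 ((A' w m z).toReal / outAvg (A' w) z) := by
        gcongr with z _ g _ m _
        exact hls m z g
    _ = ∑ z, ∑ m, ∑ w, (∑ g, (H w g).toReal) * ((Fintype.card M : ℝ)⁻¹ *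
        ((Fintype.card W : ℝ)⁻¹ * ((A' w m z).toReal *
          Real.logb 2 ((A' w m z).toReal / outAvg (A' w) z)))) := by
        refine Finset.sum_congr rfl fun z _ => ?_
        rw [Finset.sum_comm]
        refine Finset.sum_congr rfl fun m _ => ?_
        simp only [Finset.mul_sum, Finset.sum_mul]
        rw [Finset.sum_comm]
        refine Finset.sum_congr rfl fun w _ => Finset.sum_congr rfl fun g _ => ?_
        ring
    _ = _ := by
        simp only [sum_toReal_eq_one, one_mul, chanInfo_eq, Finset.mul_sum]
        rw [Finset.sum_comm]
        conv_lhs => enter [2, m]; rw [Finset.sum_comm]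
        rw [Finset.sum_comm]
        refine Finset.sum_congr rfl fun w _ => ?_
        rw [Finset.sum_comm]
        refine Finset.sum_congr rfl fun z _ => Finset.sum_congr rfl fun m _ => ?_
        ring

/-! ### Information leaked by the concatenate-and-permute code -/

variable {X Y Z S : Type*} {n : ℕ} [Fintype Z]

theorem mutualInfo_eavesLaw (c : Code X Y M n) (u : X → S → PMF Z) (s : Fin n → S) :
    mutualInfo (c.eavesLaw u s) = chanInfo (c.outLaw fun i x => u x (s i)) := by
  simp only [Code.eavesLaw, chanInfo, Code.outLaw, PMF.map_bind]

/-- Information leaked by the concatenate-and-permute code: knowledge of the permutation reduces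
the eavesdropper's observation to independent observations of the blocks. -/
theorem mutualInfo_concatPermute_le {κ : ℕ} [Fintype W] [Nonempty W] (l : ℕ) (c : Code X Y M n)
    (h : Code X Y W κ) (V : W → Equiv.Perm (Fin (l * n))) (u : X → S → PMF Z)
    (s : Fin (l * n + κ) → S) :
    mutualInfo ((concatPermute l c h V).eavesLaw u s) ≤
      ∑ j, (Fintype.card W : ℝ)⁻¹ * ∑ w, mutualInfo
        (c.eavesLaw u (block (permute (V w)⁻¹ fun i => s (Fin.castAdd κ i)) j)) := by
  rw [mutualInfo_eavesLaw]
  set Q : W → (Fin l → M) → PMF (Fin l → Fin n → Z) := fun w m => seqPMF fun j =>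
    c.outLaw (block (permute (V w)⁻¹ fun i x => u x (s (Fin.castAdd κ i))) j) (m j) with hQ
  set H : W → PMF (Fin κ → Z) := h.outLaw fun i x => u x (s (Fin.natAdd (l * n) i)) with hH
  set e : W → (Fin l → Fin n → Z) ≃ (Fin (l * n) → Z) := fun w =>
    (concatEquiv l n Z).trans (permuteEquiv (V w) Z) with he
  have hlaw : ((concatPermute l c h V).outLaw fun i x => u x (s i)) = fun m =>
      ((PMF.uniformOfFintype W).bind fun w => ((Q w m).map (e w)).bind fun z =>
        (H w).map fun g => (z, g)).map (Fin.appendEquiv (l * n) κ) := by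
    ext1 m
    rw [concatPermute_outLaw]
    simp only [PMF.map_bind, PMF.bind_map, Function.comp_apply, PMF.map_comp]
    rfl
  rw [hlaw, chanInfo_map_equiv]
  refine (chanInfo_mixture_le (fun w m => (Q w m).map (e w)) H).trans (le_of_eq ?_)
  rw [← Finset.mul_sum, Finset.sum_comm]
  congr 1
  refine Finset.sum_congr rfl fun w _ => ?_
  rw [chanInfo_map_equiv, hQ, chanInfo_seqPMF]
  refine Finset.sum_congr rfl fun j _ => ?_
  rw [mutualInfo_eavesLaw]
  rfl

theorem mutualInfo_eavesLaw_mem_Icc (c : Code X Y M n) (u : X → S → PMF Z) (s : Fin n → S) :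
    mutualInfo (c.eavesLaw u s) ∈ Set.Icc 0 (n * Real.logb 2 (Fintype.card Z)) := by
  rw [mutualInfo_eavesLaw]
  refine ⟨chanInfo_nonneg _, (chanInfo_le _).trans (le_of_eq ?_)⟩
  rw [Fintype.card_fun, Fintype.card_fin, Nat.cast_pow, Real.logb_pow]

/-- A mixture whose index `π d` can be recovered from the outcome `d`. -/
theorem bind_map_apply_of_leftInverse {γ β δ : Type*} (P : PMF γ) (E : γ → PMF β) (F : γ → β → δ)
    (π : δ → γ) (hπ : ∀ c v, π (F c v) = c) (d : δ) :
    (P.bind fun c => (E c).map (F c)) d = P (π d) * (E (π d)).map (F (π d)) d := by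
  classical
  rw [PMF.bind_apply, tsum_eq_single (π d)]
  intro c hc
  rw [PMF.map_apply]
  refine mul_eq_zero_of_right _ (ENNReal.tsum_eq_zero.2 fun v => if_neg ?_)
  rintro rfl
  exact hc (hπ c v).symm

/-- With independent states, the conditional information is the average of the information over
the state sequences. -/
theorem condMutualInfo_eavesLawIID [Fintype S] (c : Code X Y M n) (u : X → S → PMF Z)
    (q : PMF S) :
    condMutualInfo (c.eavesLawIID u q) =
      ∑ s : Fin n → S, (∏ i, (q (s i)).toReal) * mutualInfo (c.eavesLaw u s) := by
  have hq : ∀ s : Fin n → S, ((seqPMF fun _ => q) s).toReal = ∏ i, (q (s i)).toReal := by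
    intro s
    rw [seqPMF_apply, ENNReal.toReal_prod]
  have hS : (c.eavesLawIID u q).map (fun v => v.2.2) = seqPMF fun _ => q := by
    simp only [Code.eavesLawIID, PMF.map_bind, PMF.map_comp, Function.comp_def]
    exact (congrArg _ (funext fun m => PMF.map_const _ m)).trans (PMF.bind_pure _)
  have hZ : ∀ z s, (c.eavesLawIID u q).map (fun v => (v.1, v.2.2)) (z, s) =
      seqPMF (fun _ => q) s * (c.eavesLaw u s).map Prod.fst z := by
    intro z s
    simp only [Code.eavesLawIID, PMF.map_bind, PMF.map_comp, Function.comp_def]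
    rw [bind_map_apply_of_leftInverse _ _ (fun s (v : (Fin n → Z) × M) => (v.1, s)) Prod.snd
      fun _ _ => rfl]
    rw [← map_apply_of_injective ((c.eavesLaw u s).map Prod.fst) (Prod.mk_left_injective s),
      PMF.map_comp]
    rfl
  have hM : ∀ m s, (c.eavesLawIID u q).map (fun v => (v.2.1, v.2.2)) (m, s) =
      seqPMF (fun _ => q) s * (c.eavesLaw u s).map Prod.snd m := by
    intro m s
    simp only [Code.eavesLawIID, PMF.map_bind, PMF.map_comp, Function.comp_def]
    rw [bind_map_apply_of_leftInverse _ _ (fun s (v : (Fin n → Z) × M) => (v.2, s)) Prod.snd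
      fun _ _ => rfl]
    rw [← map_apply_of_injective ((c.eavesLaw u s).map Prod.snd) (Prod.mk_left_injective s),
      PMF.map_comp]
    rfl
  have hZM : ∀ z m s, c.eavesLawIID u q (z, m, s) =
      seqPMF (fun _ => q) s * c.eavesLaw u s (z, m) := by
    intro z m s
    rw [Code.eavesLawIID, bind_map_apply_of_leftInverse _ _
      (fun s (v : (Fin n → Z) × M) => (v.1, v.2, s)) (fun d => d.2.2) fun _ _ => rfl]
    have hinj : Function.Injective fun v : (Fin n → Z) × M => (v.1, v.2, s) := by
      rintro ⟨a, b⟩ ⟨a', b'⟩ h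
      simpa using h
    rw [← map_apply_of_injective (c.eavesLaw u s) hinj]
  simp only [condMutualInfo, hS, hZ, hM, hZM, ENNReal.toReal_mul, hq]
  rw [Finset.sum_congr rfl fun z _ => Finset.sum_comm, Finset.sum_comm]
  refine Finset.sum_congr rfl fun s _ => ?_
  simp only [mutualInfo, Finset.mul_sum]
  refine Finset.sum_congr rfl fun z _ => Finset.sum_congr rfl fun m _ => ?_
  by_cases h0 : ∏ i, (q (s i)).toReal = 0
  · simp [h0]
  · rw [mul_div_cancel_left₀ _ h0, mul_div_cancel_left₀ _ h0, mul_div_cancel_left₀ _ h0, mul_assoc]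

end Information

/-! ### Stirling estimates -/

theorem factorial_le_stirling {m : ℕ} (hm : 1 ≤ m) :
    (m.factorial : ℝ) ≤ Real.exp 1 * √m * (m / Real.exp 1) ^ m := by
  obtain ⟨k, rfl⟩ : ∃ k, m = k + 1 := ⟨m - 1, by omega⟩
  have h := Stirling.stirlingSeq'_antitone (Nat.zero_le k)
  simp only [Function.comp_apply, Nat.succ_eq_add_one, zero_add, Stirling.stirlingSeq_one] at h
  rw [Stirling.stirlingSeq, div_le_iff₀ (by positivity), Real.sqrt_mul zero_le_two] at h
  refine h.trans (le_of_eq ?_)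
  have : √2 ≠ 0 := by positivity
  field_simp

theorem five_halves_le_sqrt_two_pi : 5 / 2 ≤ √(2 * Real.pi) :=
  Real.le_sqrt_of_sq_le (by linarith [Real.pi_gt_d2])

theorem exp_one_le : Real.exp 1 ≤ 2.72 := by linarith [Real.exp_one_lt_d9]

/-- The probability that a Poisson variable of mean `A` takes the value `x` is `O(1 / √A)`,
uniformly in `x`. -/
theorem sqrt_mul_pow_le (x : ℕ) {A : ℝ} (hA : 0 < A) :
    Real.exp 1 * (√A * A ^ x) ≤ √(2 * Real.pi) * x.factorial * Real.exp A := by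
  have h25 := five_halves_le_sqrt_two_pi
  have he := exp_one_le
  rcases Nat.eq_zero_or_pos x with rfl | hx
  · have h2 : Real.exp 1 ≤ 2 * √(2 * Real.pi) := by linarith
    have h3 : √A ≤ Real.exp A / 2 := by
      nlinarith [Real.add_one_le_exp A, Real.sq_sqrt hA.le, sq_nonneg (√A - 1), Real.sqrt_nonneg A]
    simp only [pow_zero, mul_one, Nat.factorial_zero, Nat.cast_one]
    calc Real.exp 1 * √A ≤ (2 * √(2 * Real.pi)) * (Real.exp A / 2) := by gcongr
      _ = _ := by ring
  have hx0 : (0 : ℝ) < x := by exact_mod_cast hx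
  have hx1 : (1 : ℝ) ≤ x := by exact_mod_cast hx
  obtain ⟨y, hy, rfl⟩ : ∃ y : ℝ, 0 < y ∧ A = x * y := ⟨A / x, by positivity, by field_simp⟩
  -- `y ↦ (x + 1/2) * log y - x * y` is maximal at `y = 1 + 1 / (2 * x)`
  have hlog : ((x : ℝ) + 1 / 2) * Real.log y ≤ x * (y - 1) + 1 / 4 := by
    set t : ℝ := 1 + 1 / (2 * x) with ht
    have htpos : 0 < t := by positivity
    have h1 := Real.log_le_sub_one_of_pos (div_pos hy htpos)
    rw [Real.log_div hy.ne' htpos.ne'] at h1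
    have h2 := Real.log_le_sub_one_of_pos htpos
    have h3 : Real.log y ≤ y / t - 1 + (t - 1) := by linarith
    have h4 : ((x : ℝ) + 1 / 2) = x * t := by rw [ht]; field_simp
    calc ((x : ℝ) + 1 / 2) * Real.log y ≤ (x * t) * (y / t - 1 + (t - 1)) := by
          rw [h4]; gcongr
      _ = x * (y - 1) + x * (t - 1) ^ 2 := by field_simp; ring
      _ ≤ x * (y - 1) + 1 / 4 := by
          have : x * (t - 1) ^ 2 = 1 / (4 * x) := by rw [ht]; field_simp; ring
          rw [this]
          gcongr
          linarith
  have hy' : √y * y ^ x ≤ Real.exp (x * (y - 1)) * Real.exp (1 / 4) := by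
    rw [← Real.exp_add]
    refine le_trans (le_of_eq ?_) (Real.exp_le_exp.2 hlog)
    rw [add_mul, Real.exp_add, mul_comm (x : ℝ) (Real.log y), mul_comm (1 / 2 : ℝ),
      ← Real.rpow_def_of_pos hy, ← Real.rpow_def_of_pos hy, Real.rpow_natCast, Real.sqrt_eq_rpow,
      mul_comm]
  have hst := Stirling.le_factorial_stirling x
  have hconst : Real.exp 1 * Real.exp (1 / 4) ≤ √(2 * Real.pi) * √(2 * Real.pi) := by
    have h14 : Real.exp (1 / 4) ≤ 2 := by
      have : Real.exp (1 / 4) ^ 4 ≤ 2 ^ 4 := by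
        rw [← Real.exp_nat_mul]
        norm_num
        linarith
      exact le_of_pow_le_pow_left₀ (by norm_num) (by norm_num) this
    nlinarith [Real.exp_pos 1]
  calc Real.exp 1 * (√(x * y) * (x * y) ^ x)
      = Real.exp 1 * √x * x ^ x * (√y * y ^ x) := by
        rw [Real.sqrt_mul hx0.le, mul_pow]; ring
    _ ≤ Real.exp 1 * √x * x ^ x * (Real.exp (x * (y - 1)) * Real.exp (1 / 4)) := by gcongr
    _ = (Real.exp 1 * Real.exp (1 / 4)) * (√x * x ^ x * Real.exp (x * (y - 1))) := by ring
    _ ≤ (√(2 * Real.pi) * √(2 * Real.pi)) * (√x * x ^ x * Real.exp (x * (y - 1))) := by gcongr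
    _ = √(2 * Real.pi) * (√(2 * Real.pi * x) * (x / Real.exp 1) ^ x) * Real.exp (x * y) := by
        rw [Real.sqrt_mul Real.two_pi_pos.le x, div_pow, ← Real.exp_nat_mul, mul_sub,
          Real.exp_sub, mul_one]
        field_simp
    _ ≤ _ := by gcongr

/-- The number of ways to draw `k` of `m` elements in order, compared with the number `m ^ k` of
draws with replacement. The parameter `ρ` is the ratio of population size to remaining
population size. -/
theorem descFactorial_le {m k : ℕ} (hk : k ≤ m) {ρ : ℝ} (hρ : 1 ≤ ρ) :
    (m.descFactorial k : ℝ) ≤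
      √(2 * Real.pi * ρ) * (ρ ^ (m - k) * m ^ k * Real.exp (m / ρ - m)) := by
  have h25 := five_halves_le_sqrt_two_pi
  have hρ0 : 0 < ρ := by linarith
  rw [Real.sqrt_mul Real.two_pi_pos.le ρ]
  rcases Nat.eq_zero_or_pos m with rfl | hm
  · obtain rfl : k = 0 := by omega
    have : 1 ≤ √ρ := Real.one_le_sqrt.2 hρ
    simp only [Nat.descFactorial_zero, Nat.cast_one, Nat.sub_zero, pow_zero, CharP.cast_eq_zero,
      zero_div, sub_zero, Real.exp_zero, mul_one]
    nlinarith
  have hm0 : (0 : ℝ) < m := by exact_mod_cast hm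
  obtain ⟨x, rfl⟩ : ∃ x, m = x + k := ⟨m - k, by omega⟩
  set m := x + k with hmdef
  have hfac : ((m - k).factorial : ℝ) * m.descFactorial k = m.factorial := by
    exact_mod_cast Nat.factorial_mul_descFactorial hk
  have hx : m - k = x := by omega
  rw [hx] at hfac ⊢
  have hP := sqrt_mul_pow_le x (show 0 < (m : ℝ) / ρ by positivity)
  have hxf : (0 : ℝ) < x.factorial := by exact_mod_cast Nat.factorial_pos x
  refine le_of_mul_le_mul_left ?_ hxf
  rw [hfac]
  refine (factorial_le_stirling hm).trans ?_
  have hsq : √(m / ρ : ℝ) * √ρ = √m := by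
    rw [← Real.sqrt_mul (by positivity), div_mul_cancel₀ _ hρ0.ne']
  have hpow : ((m : ℝ) / Real.exp 1) ^ m = (m / ρ) ^ x * ρ ^ x * m ^ k * Real.exp (-m) := by
    rw [div_pow, ← Real.exp_nat_mul, mul_one, Real.exp_neg, ← mul_pow, div_mul_cancel₀ _ hρ0.ne',
      ← pow_add, ← hmdef, div_eq_mul_inv]
  rw [hpow, ← hsq, sub_eq_add_neg, Real.exp_add]
  calc _ = (Real.exp 1 * (√(m / ρ) * (m / ρ) ^ x)) * (√ρ * ρ ^ x * m ^ k * Real.exp (-m)) := by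
        ring
    _ ≤ (√(2 * Real.pi) * x.factorial * Real.exp (m / ρ)) *
        (√ρ * ρ ^ x * m ^ k * Real.exp (-m)) := by gcongr
    _ = _ := by ring

/-- The prefactor of `mu` dominates the ratio of the two constants in Stirling's formula. -/
theorem exp_one_le_const_mul_sqrt_two_pi :
    Real.exp 1 ≤ √2 * Real.exp (-(1 / 4)) * (13 / 11) * √(2 * Real.pi) := by
  have h25 := five_halves_le_sqrt_two_pi
  have he := exp_one_le
  have h1 : (1.4 : ℝ) ≤ √2 := Real.le_sqrt_of_sq_le (by norm_num)
  have h2 : (3 / 4 : ℝ) ≤ Real.exp (-(1 / 4)) := by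
    have := Real.add_one_le_exp (-(1 / 4) : ℝ)
    linarith
  calc Real.exp 1 ≤ 1.4 * (3 / 4) * (13 / 11) * (5 / 2) := by linarith
    _ ≤ _ := by gcongr

theorem factorial_mul_pow_le {N K : ℕ} (hK : 1 ≤ K) (hKN : K ≤ N) :
    (K.factorial : ℝ) * (N : ℝ) ^ (N - K) * ((N : ℝ) / K) ^ K ≤
      √2 * Real.exp (-(1 / 4)) * (13 / 11) * N.factorial * Real.exp (N - K) := by
  have hK0 : (0 : ℝ) < K := by exact_mod_cast hK
  have hN0 : (0 : ℝ) < N := by exact_mod_cast hK.trans hKN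
  set C := √2 * Real.exp (-(1 / 4)) * (13 / 11) with hC
  have hCpos : 0 < C := by positivity
  calc (K.factorial : ℝ) * (N : ℝ) ^ (N - K) * ((N : ℝ) / K) ^ K
      ≤ (Real.exp 1 * √K * (K / Real.exp 1) ^ K) * (N : ℝ) ^ (N - K) * ((N : ℝ) / K) ^ K := by
        gcongr
        exact factorial_le_stirling hK
    _ = Real.exp 1 * √K * ((N : ℝ) ^ N * Real.exp (-K)) := by
        rw [show (N : ℝ) ^ N = (N : ℝ) ^ (N - K) * (N : ℝ) ^ K by
          rw [← pow_add, Nat.sub_add_cancel hKN], div_pow, div_pow, ← Real.exp_nat_mul, mul_one,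
          Real.exp_neg]
        field_simp
    _ ≤ (C * √(2 * Real.pi)) * √N * ((N : ℝ) ^ N * Real.exp (-K)) := by
        gcongr
        exact exp_one_le_const_mul_sqrt_two_pi
    _ = C * (√(2 * Real.pi * N) * (N / Real.exp 1) ^ N) * Real.exp (N - K) := by
        rw [Real.sqrt_mul Real.two_pi_pos.le N, div_pow, ← Real.exp_nat_mul, mul_one, sub_eq_add_neg,
          Real.exp_add]
        field_simp
    _ ≤ _ := by
        gcongr
        exact Stirling.le_factorial_stirling N

/-! ### Sampling without replacement -/

/-- The number of permutations under which the positions `e` of the permuted sequence read `v`. -/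
theorem card_perm_pattern_le {ι α S : Type*} [Fintype ι] [Fintype α] [DecidableEq α] [Fintype S]
    [DecidableEq S] (s : α → S) (e : ι ↪ α) (v : ι → S) :
    Fintype.card {σ : Equiv.Perm α // ∀ i, s (σ (e i)) = v i} ≤
      (Fintype.card α - Fintype.card ι).factorial *
        ∏ a, (Fintype.card {x // s x = a}).descFactorial (Fintype.card {i // v i = a}) := by
  classical
  set r : {σ : Equiv.Perm α // ∀ i, s (σ (e i)) = v i} →
      (∀ a, {i // v i = a} ↪ {x // s x = a}) := fun σ a =>
    ⟨fun i => ⟨σ.1 (e i.1), (σ.2 i.1).trans i.2⟩, fun i j hij => by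
      have := Subtype.ext_iff.1 hij
      exact Subtype.ext (e.injective (σ.1.injective this))⟩ with hr
  have hfib : ∀ g ∈ (Finset.univ : Finset (∀ a, {i // v i = a} ↪ {x // s x = a})),
      (Finset.univ.filter fun σ => r σ = g).card ≤
        (Fintype.card α - Fintype.card ι).factorial := by
    intro g _
    rcases (Finset.univ.filter fun σ => r σ = g).eq_empty_or_nonempty with h | ⟨σ₀, h₀⟩
    · rw [h]; simp
    have hσ₀ : r σ₀ = g := by simpa using h₀
    -- two such permutations agree on the positions `e`
    have hagree : ∀ σ, r σ = g → ∀ i, σ.1 (e i) = σ₀.1 (e i) := by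
      intro σ hσ i
      have := congrArg (fun f => ((f (v i)) ⟨i, rfl⟩).1) (hσ.trans hσ₀.symm)
      exact this
    have hcompl : Fintype.card {x // x ∉ Set.range e} = Fintype.card α - Fintype.card ι := by
      have h1 := Fintype.card_compl_set (Set.range e)
      rw [Set.card_range_of_injective e.injective] at h1
      exact (Fintype.card_congr (Equiv.refl _)).trans h1
    rw [← Fintype.card_subtype, ← hcompl, ← Fintype.card_perm]
    refine Fintype.card_le_of_injective (fun σ : {σ // r σ = g} =>
      (σ₀.1⁻¹ * σ.1.1).subtypePerm (p := fun x => x ∉ Set.range e) ?_) ?_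
    · intro x
      refine not_congr ⟨?_, ?_⟩
      · rintro ⟨i, hi⟩
        refine ⟨i, σ.1.1.injective ?_⟩
        rw [hagree σ.1 σ.2, hi]
        simp
      · rintro ⟨i, rfl⟩
        exact ⟨i, by simp [hagree σ.1 σ.2]⟩
    · intro σ τ hστ
      refine Subtype.ext (Subtype.ext (Equiv.ext fun x => ?_))
      by_cases hx : x ∈ Set.range e
      · obtain ⟨i, rfl⟩ := hx
        rw [hagree σ.1 σ.2, hagree τ.1 τ.2]
      · have := congrArg (fun p => (p ⟨x, hx⟩).1) hστ
        simpa using this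
  have := Finset.card_le_mul_card_image_of_maps_to (s := Finset.univ) (t := Finset.univ) (f := r)
    (fun _ _ => Finset.mem_univ _) _ hfib
  rw [Finset.card_univ, Finset.card_univ, Fintype.card_pi] at this
  simpa [Fintype.card_embedding_eq] using this

/-- Sampling without replacement is dominated by i.i.d. sampling. A uniformly permuted sequence
of length `N` whose letter counts `s` satisfy `#s⁻¹(a) ≤ (N + κ) q(a)` shows the word `v` at
`n` given positions with probability at most `mu * exp (κ / l) * ∏ i, q (v i)`, where
`N = l * n`. -/
theorem card_perm_pattern_le_mu {ι α S : Type*} [Fintype ι] [Fintype α] [DecidableEq α]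
    [Fintype S] [DecidableEq S] (s : α → S) (e : ι ↪ α) (v : ι → S) {l : ℕ} (κ : ℕ) (hl : 2 ≤ l)
    [Nonempty ι] (hN : Fintype.card α = l * Fintype.card ι) (q : S → ℝ) (hq0 : ∀ a, 0 ≤ q a)
    (hq : ∀ a, (Fintype.card {x // s x = a} : ℝ) ≤ (Fintype.card α + κ) * q a) :
    (Fintype.card {σ : Equiv.Perm α // ∀ i, s (σ (e i)) = v i} : ℝ) ≤
      (Fintype.card α).factorial *
        (mu l (Fintype.card S) * Real.exp (κ / l) * ∏ i, q (v i)) := by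
  have hcard := card_perm_pattern_le s e v
  set N := Fintype.card α with hNdef
  set n := Fintype.card ι with hndef
  set Na : S → ℕ := fun a => Fintype.card {x // s x = a} with hNa
  set ka : S → ℕ := fun a => Fintype.card {i // v i = a} with hka
  have hprodq : ∏ i, q (v i) = ∏ a, q a ^ ka a := by
    rw [← Fintype.prod_fiberwise (g := v)]
    refine Finset.prod_congr rfl fun a _ => ?_
    rw [Finset.prod_congr rfl fun (i : {i // v i = a}) _ => by rw [i.2]]
    simp [hka]
  have hl1 : (1 : ℝ) < l := by exact_mod_cast hl
  have hmu : 0 ≤ mu l (Fintype.card S) := by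
    unfold mu
    have : 0 < (l : ℝ) - 1 := by linarith
    positivity
  have hRHS : 0 ≤ (N.factorial : ℝ) *
      (mu l (Fintype.card S) * Real.exp (κ / l) * ∏ i, q (v i)) :=
    mul_nonneg (by positivity) (mul_nonneg (mul_nonneg hmu (Real.exp_pos _).le)
      (Finset.prod_nonneg fun i _ => hq0 _))
  by_cases hall : ∀ a, ka a ≤ Na a
  swap
  · push Not at hall
    obtain ⟨a, ha⟩ := hall
    rw [Finset.prod_eq_zero (Finset.mem_univ a) (Nat.descFactorial_of_lt ha), mul_zero,
      Nat.le_zero] at hcard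
    rw [hcard]
    simpa using hRHS
  have hn : 1 ≤ n := Fintype.card_pos
  have hKeq : N - n = n * (l - 1) := by rw [hN, Nat.mul_sub_one, mul_comm]
  have hK1 : 1 ≤ N - n := by
    rw [hKeq]; exact Nat.mul_pos hn (by omega)
  have hKN : N - n ≤ N := Nat.sub_le _ _
  have hnN : n ≤ N := by omega
  have hNR : (N : ℝ) = l * n := by rw [hN]; push_cast; ring
  have hsumN : ∑ a, Na a = N := by
    rw [hNa, ← Fintype.card_sigma, hNdef]
    exact Fintype.card_congr (Equiv.sigmaFiberEquiv s)
  have hsumk : ∑ a, ka a = n := by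
    rw [hka, ← Fintype.card_sigma, hndef]
    exact Fintype.card_congr (Equiv.sigmaFiberEquiv v)
  have hsumK : ∑ a, (Na a - ka a) = N - n := by
    rw [Finset.sum_tsub_distrib _ fun a _ => hall a, hsumN, hsumk]
  set K := N - n with hK
  have hKR : (K : ℝ) = N - n := by rw [hK, Nat.cast_sub hnN]
  have hn0 : (0 : ℝ) < n := by exact_mod_cast hn
  have hN0 : (0 : ℝ) < N := by rw [hNR]; positivity
  have hK0 : (0 : ℝ) < K := by exact_mod_cast hK1
  set ρ : ℝ := N / K with hρdef
  have hρl : ρ = l / (l - 1) := by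
    rw [hρdef, hKR, hNR, show (l : ℝ) * n - n = (l - 1) * n by ring,
      mul_div_mul_right _ _ hn0.ne']
  have hρ : 1 ≤ ρ := by
    rw [hρdef, one_le_div hK0]; exact_mod_cast hKN
  have hNρ : (N : ℝ) / ρ = K := by rw [hρdef]; field_simp
  have hmu_eq : mu l (Fintype.card S) =
      √2 * Real.exp (-(1 / 4)) * (13 / 11) * √(2 * Real.pi * ρ) ^ Fintype.card S := by
    rw [mu, hρl, Real.sqrt_eq_rpow (2 * Real.pi * _), ← Real.rpow_natCast, ← Real.rpow_mul,
      mul_div_assoc]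
    · congr 2
      ring
    · rw [← hρl]; positivity
  have hprodN : ∏ a, (Na a : ℝ) ^ ka a ≤ ((N : ℝ) ^ n * Real.exp (κ / l)) * ∏ i, q (v i) := by
    calc ∏ a, (Na a : ℝ) ^ ka a ≤ ∏ a, ((N + κ) * q a) ^ ka a := by
          refine Finset.prod_le_prod (fun a _ => by positivity) fun a _ => ?_
          exact pow_le_pow_left₀ (by positivity) (hq a) _
      _ = (N + κ : ℝ) ^ n * ∏ i, q (v i) := by
          simp_rw [mul_pow]
          rw [Finset.prod_mul_distrib, Finset.prod_pow_eq_pow_sum, hsumk, hprodq]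
      _ ≤ _ := by
          refine mul_le_mul_of_nonneg_right ?_ (Finset.prod_nonneg fun i _ => hq0 _)
          have h1 : (N + κ : ℝ) = N * (κ / N + 1) := by field_simp; ring
          rw [h1, mul_pow]
          refine mul_le_mul_of_nonneg_left ?_ (by positivity)
          calc (κ / N + 1 : ℝ) ^ n ≤ Real.exp (κ / N) ^ n :=
                pow_le_pow_left₀ (by positivity) (Real.add_one_le_exp _) _
            _ = Real.exp (κ / l) := by
                rw [← Real.exp_nat_mul, hNR]
                congr 1
                have : (l : ℝ) ≠ 0 := by positivity
                field_simp
  have hprodD : ((∏ a, (Na a).descFactorial (ka a) : ℕ) : ℝ) ≤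
      √(2 * Real.pi * ρ) ^ Fintype.card S *
        (ρ ^ K * (∏ a, (Na a : ℝ) ^ ka a) * Real.exp (K - N)) := by
    push_cast
    calc ∏ a, ((Na a).descFactorial (ka a) : ℝ) ≤ ∏ a, (√(2 * Real.pi * ρ) *
          (ρ ^ (Na a - ka a) * (Na a : ℝ) ^ ka a * Real.exp (Na a / ρ - Na a))) :=
          Finset.prod_le_prod (fun a _ => by positivity) fun a _ => descFactorial_le (hall a) hρ
      _ = _ := by
          rw [Finset.prod_mul_distrib, Finset.prod_mul_distrib, Finset.prod_mul_distrib,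
            Finset.prod_pow_eq_pow_sum, hsumK, ← Real.exp_sum, Finset.sum_sub_distrib,
            ← Finset.sum_div, ← Nat.cast_sum, hsumN, hNρ, Finset.prod_const, Finset.card_univ]
  have hlead := factorial_mul_pow_le hK1 hKN
  have hNK : N - K = n := by omega
  rw [hNK, ← hρdef] at hlead
  set Q := ∏ i, q (v i) with hQ
  have hQ0 : 0 ≤ Q := Finset.prod_nonneg fun i _ => hq0 _
  set R := √(2 * Real.pi * ρ) ^ Fintype.card S with hR
  have hR0 : 0 ≤ R := by positivity
  calc (Fintype.card {σ : Equiv.Perm α // ∀ i, s (σ (e i)) = v i} : ℝ)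
      ≤ (K.factorial : ℝ) * ((∏ a, (Na a).descFactorial (ka a) : ℕ) : ℝ) := by exact_mod_cast hcard
    _ ≤ K.factorial * (R * (ρ ^ K * (((N : ℝ) ^ n * Real.exp (κ / l)) * Q) *
        Real.exp (K - N))) := by
        refine mul_le_mul_of_nonneg_left (hprodD.trans ?_) (by positivity)
        gcongr
    _ = (K.factorial * (N : ℝ) ^ n * ρ ^ K) * (R * Real.exp (κ / l) * Q * Real.exp (K - N)) := by
        ring
    _ ≤ (√2 * Real.exp (-(1 / 4)) * (13 / 11) * N.factorial * Real.exp (N - K)) *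
        (R * Real.exp (κ / l) * Q * Real.exp (K - N)) := by gcongr
    _ = (√2 * Real.exp (-(1 / 4)) * (13 / 11) * N.factorial) *
        (R * Real.exp (κ / l) * Q) * (Real.exp (N - K) * Real.exp (K - N)) := by ring
    _ = _ := by
        rw [← Real.exp_add, show (N : ℝ) - K + (K - N) = 0 by ring, Real.exp_zero, hmu_eq]
        ring

theorem mu_pos {l : ℕ} (hl : 2 ≤ l) (k : ℕ) : 0 < mu l k := by
  have hl1 : (1 : ℝ) < l := by exact_mod_cast hl
  have : 0 < (l : ℝ) - 1 := by linarith
  unfold mu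
  positivity

/-- Averaging form of `card_perm_pattern_le_mu`: the mean of a nonnegative function of a block of
a randomly permuted state sequence is controlled by its mean under i.i.d. states. -/
theorem average_block_permute_le {n l κ : ℕ} {S : Type*} [Fintype S] (hn : 1 ≤ n) (hl : 2 ≤ l)
    (q : PMF S) (s : Fin (l * n + κ) → S) (hs : s ∈ typeClass (l * n + κ) q)
    (f : (Fin n → S) → ℝ) (hf : ∀ v, 0 ≤ f v) (j : Fin l) :
    ((Fintype.card (Equiv.Perm (Fin (l * n))) : ℝ))⁻¹ *
        ∑ σ : Equiv.Perm (Fin (l * n)),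
          f (block (permute σ⁻¹ fun i => s (Fin.castAdd κ i)) j) ≤
      mu l (Fintype.card S) * Real.exp (κ / l) * ∑ v, (∏ i, (q (v i)).toReal) * f v := by
  classical
  have : Nonempty (Fin n) := ⟨⟨0, hn⟩⟩
  set s' : Fin (l * n) → S := fun i => s (Fin.castAdd κ i) with hs'
  set e : Fin n ↪ Fin (l * n) := ⟨fun i => finProdFinEquiv (j, i), fun a b h => by
    simpa using h⟩ with he
  have hcount : ∀ a, (Fintype.card {x // s' x = a} : ℝ) ≤
      (Fintype.card (Fin (l * n)) + κ) * (q a).toReal := by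
    intro a
    have h1 : (({i | s i = a}.ncard : ℕ) : ℝ) = ((l * n + κ : ℕ) : ℝ) * (q a).toReal := hs a
    rw [Fintype.card_fin, ← Nat.cast_add, ← h1, Nat.cast_le, ← Nat.card_coe_set_eq,
      Nat.card_eq_fintype_card]
    refine Fintype.card_le_of_injective (fun x : {x // s' x = a} =>
      (⟨Fin.castAdd κ x.1, x.2⟩ : {i | s i = a})) fun x y hxy => ?_
    exact Subtype.ext (Fin.castAdd_injective _ _ (Subtype.ext_iff.1 hxy))
  have hpat := fun v => card_perm_pattern_le_mu s' e v κ hl (by simp) (fun a => (q a).toReal)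
    (fun _ => ENNReal.toReal_nonneg) hcount
  have hpos : (0 : ℝ) < Fintype.card (Equiv.Perm (Fin (l * n))) := by
    exact_mod_cast Fintype.card_pos
  rw [inv_mul_le_iff₀ hpos, ← Equiv.sum_comp (Equiv.inv (Equiv.Perm (Fin (l * n))))]
  simp only [Equiv.inv_apply, inv_inv]
  rw [← Fintype.sum_fiberwise (g := fun σ : Equiv.Perm (Fin (l * n)) =>
    block (permute σ s') j), Finset.mul_sum, Finset.mul_sum]
  refine Finset.sum_le_sum fun v _ => ?_
  rw [Finset.sum_congr rfl fun (σ : {σ // block (permute σ s') j = v}) _ => by rw [σ.2],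
    Finset.sum_const, nsmul_eq_mul, Finset.card_univ, Fintype.card_perm]
  have hc : Fintype.card {σ : Equiv.Perm (Fin (l * n)) // block (permute σ s') j = v} =
      Fintype.card {σ : Equiv.Perm (Fin (l * n)) // ∀ i, s' (σ (e i)) = v i} :=
    Fintype.card_congr (Equiv.subtypeEquivRight fun σ => funext_iff)
  have hpv := mul_le_mul_of_nonneg_right (hpat v) (hf v)
  rw [hc]
  convert hpv using 1
  · congr!
  · ring

/-! ### Concentration over the random permutations -/

/-- Hoeffding's inequality for the average of a bounded function of independent random variables,
uniform on a finite set. -/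
theorem measure_average_ge_le {W Ω G : Type*} [Fintype W] [Nonempty W] [MeasurableSpace Ω]
    (P : Measure Ω) [IsProbabilityMeasure P] [Fintype G] [Nonempty G] [MeasurableSpace G]
    [DiscreteMeasurableSpace G] (Υ : W → Ω → G) (hmeas : ∀ w, Measurable (Υ w))
    (hindep : iIndepFun Υ P) (hunif : ∀ w, P.map (Υ w) = (PMF.uniformOfFintype G).toMeasure)
    (g : G → ℝ) {b m lam : ℝ} (hb : 0 < b) (hg : ∀ x, g x ∈ Set.Icc 0 b)
    (hm : (Fintype.card G : ℝ)⁻¹ * ∑ x, g x ≤ m) (hlam : 0 < lam) :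
    P.real {ω | m + lam ≤ (Fintype.card W : ℝ)⁻¹ * ∑ w, g (Υ w ω)} ≤
      Real.exp (-(2 * Fintype.card W * (lam / b) ^ 2)) := by
  have hW : (0 : ℝ) < Fintype.card W := by exact_mod_cast Fintype.card_pos
  have hgm : Measurable g := Measurable.of_discrete
  set a := (Fintype.card G : ℝ)⁻¹ * ∑ x, g x with ha
  have hmean : ∀ w, P[fun ω => g (Υ w ω)] = a := by
    intro w
    rw [← integral_map (hmeas w).aemeasurable hgm.aestronglyMeasurable, hunif w,
      PMF.integral_eq_sum]
    simp [ha, Finset.mul_sum]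
  have hsub : ∀ w ∈ (Finset.univ : Finset W),
      HasSubgaussianMGF (fun ω => g (Υ w ω) - a) ((‖b - 0‖₊ / 2) ^ 2) P := by
    intro w _
    have := hasSubgaussianMGF_of_mem_Icc (μ := P) (X := fun ω => g (Υ w ω))
      (hgm.comp (hmeas w)).aemeasurable (ae_of_all _ fun ω => hg (Υ w ω))
    rwa [hmean] at this
  have hind : iIndepFun (fun w ω => g (Υ w ω) - a) P :=
    hindep.comp (fun _ x => g x - a) fun _ => Measurable.of_discrete
  have hH := HasSubgaussianMGF.measure_sum_ge_le_of_iIndepFun hind hsub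
    (ε := Fintype.card W * lam) (by positivity)
  refine (measureReal_mono ?_).trans (hH.trans (le_of_eq ?_))
  · intro ω hω
    simp only [Set.mem_ofPred_eq] at hω ⊢
    rw [le_inv_mul_iff₀ hW] at hω
    rw [Finset.sum_sub_distrib, Finset.sum_const, Finset.card_univ, nsmul_eq_mul]
    nlinarith
  · congr 1
    have : ((‖b‖₊ : NNReal) : ℝ) = b := by simp [abs_of_pos hb]
    simp only [sub_zero, Finset.sum_const, Finset.card_univ, nsmul_eq_mul]
    push_cast
    rw [show ‖b‖ = b by simp [abs_of_pos hb]]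
    field_simp

theorem logb_two_natCast_le {k : ℕ} (hk : 1 ≤ k) : Real.logb 2 k ≤ k - 1 / 2 := by
  obtain ⟨m, rfl⟩ : ∃ m, k = m + 1 := ⟨k - 1, by omega⟩
  have h : ((m + 1 : ℕ) : ℝ) ≤ 2 ^ (m : ℝ) := by
    rw [Real.rpow_natCast]
    exact_mod_cast Nat.lt_two_pow_self
  have := (Real.logb_le_iff_le_rpow one_lt_two (by positivity)).2 h
  push_cast at this ⊢
  linarith

/-- Over the random permutations, the average information leaked through one block exceeds its
typical value by `lam` with exponentially small probability. The inequality is strict because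
`logb 2 |Z| < |Z|`. -/
theorem measure_block_leakage_lt {X Y Z S M W Ω : Type*} [Fintype Z] [Nonempty Z] [Fintype S]
    [Fintype M] [Nonempty M] [Fintype W] [Nonempty W] (u : X → S → PMF Z) (q : PMF S)
    {n l κ : ℕ} (hn : 1 ≤ n) (hl : 2 ≤ l) {d lam : ℝ} (hlam : 0 < lam) (c : Code X Y M n)
    (hd : condMutualInfo (c.eavesLawIID u q) ≤ d)
    [MeasurableSpace Ω] (P : Measure Ω) [IsProbabilityMeasure P]
    (Υ : W → Ω → Equiv.Perm (Fin (l * n))) (hmeas : ∀ w, Measurable (Υ w))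
    (hindep : iIndepFun Υ P)
    (hunif : ∀ w, P.map (Υ w) = (PMF.uniformOfFintype (Equiv.Perm (Fin (l * n)))).toMeasure)
    (s : Fin (l * n + κ) → S) (hs : s ∈ typeClass (l * n + κ) q) (j : Fin l) :
    P.real {ω | mu l (Fintype.card S) * Real.exp (κ / l) * d + lam ≤
        (Fintype.card W : ℝ)⁻¹ * ∑ w, mutualInfo
          (c.eavesLaw u (block (permute (Υ w ω)⁻¹ fun i => s (Fin.castAdd κ i)) j))} <
      Real.exp (-(2 * Fintype.card W * (lam / (n * Fintype.card Z)) ^ 2)) := by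
  have hW : (0 : ℝ) < Fintype.card W := by exact_mod_cast Fintype.card_pos
  have hZ : (1 : ℝ) ≤ Fintype.card Z := by exact_mod_cast Fintype.card_pos
  have hn0 : (0 : ℝ) < n := by exact_mod_cast hn
  have : DiscreteMeasurableSpace (Equiv.Perm (Fin (l * n))) := ⟨fun _ => trivial⟩
  have hb : 0 < n * ((Fintype.card Z : ℝ) - 1 / 2) := mul_pos hn0 (by linarith)
  have hmean := average_block_permute_le hn hl q s hs (fun v => mutualInfo (c.eavesLaw u v))
    (fun v => (mutualInfo_eavesLaw_mem_Icc c u v).1) j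
  rw [← condMutualInfo_eavesLawIID] at hmean
  have hmean' := hmean.trans (mul_le_mul_of_nonneg_left hd
    (mul_pos (mu_pos hl _) (Real.exp_pos _)).le)
  refine (measure_average_ge_le P Υ hmeas hindep hunif
    (fun σ => mutualInfo (c.eavesLaw u (block (permute σ⁻¹ fun i => s (Fin.castAdd κ i)) j)))
    hb (fun σ => ?_) hmean' hlam).trans_lt ?_
  · refine ⟨(mutualInfo_eavesLaw_mem_Icc c u _).1, (mutualInfo_eavesLaw_mem_Icc c u _).2.trans ?_⟩
    exact mul_le_mul_of_nonneg_left (logb_two_natCast_le Fintype.card_pos) hn0.le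
  · rw [Real.exp_lt_exp, neg_lt_neg_iff]
    refine mul_lt_mul_of_pos_left ?_ (by positivity)
    refine pow_lt_pow_left₀ ?_ (by positivity) two_ne_zero
    refine div_lt_div_of_pos_left hlam hb ?_
    exact mul_lt_mul_of_pos_left (by linarith) hn0

/-- Union bound over blocks and state sequences. A leakage that is too large in total is too large
on average for some block, and the leakage through a block only involves the first `l * n` states,
so that `l * |S| ^ (l * n)` terms suffice. -/
theorem measure_exists_leakage_lt {X Y Z S M W Ω : Type*} [Fintype Z] [Nonempty Z] [Fintype S]
    [Fintype M] [Nonempty M] [Fintype W] [Nonempty W] (u : X → S → PMF Z) (q : PMF S)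
    {n l κ : ℕ} (hn : 1 ≤ n) (hl : 2 ≤ l) {d lam : ℝ} (hlam : 0 < lam) (c : Code X Y M n)
    (h : Code X Y W κ) (hd : condMutualInfo (c.eavesLawIID u q) ≤ d)
    [MeasurableSpace Ω] (P : Measure Ω) [IsProbabilityMeasure P]
    (Υ : W → Ω → Equiv.Perm (Fin (l * n))) (hmeas : ∀ w, Measurable (Υ w))
    (hindep : iIndepFun Υ P)
    (hunif : ∀ w, P.map (Υ w) = (PMF.uniformOfFintype (Equiv.Perm (Fin (l * n)))).toMeasure) :
    P.real {ω | ∃ s ∈ typeClass (l * n + κ) q,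
        l * (mu l (Fintype.card S) * Real.exp (κ / l) * d + lam) <
          mutualInfo ((concatPermute l c h fun w => Υ w ω).eavesLaw u s)} <
      l * (Fintype.card S : ℝ) ^ (n * l) *
        Real.exp (-(2 * Fintype.card W * (lam / (n * Fintype.card Z)) ^ 2)) := by
  classical
  set B := Real.exp (-(2 * Fintype.card W * (lam / (n * Fintype.card Z)) ^ 2)) with hB
  set T := mu l (Fintype.card S) * Real.exp (κ / l) * d + lam with hT
  set E : (Fin (l * n) → S) × Fin l → Set Ω := fun p =>
    {ω | (∃ s ∈ typeClass (l * n + κ) q, (fun i => s (Fin.castAdd κ i)) = p.1) ∧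
      T ≤ (Fintype.card W : ℝ)⁻¹ * ∑ w, mutualInfo
        (c.eavesLaw u (block (permute (Υ w ω)⁻¹ p.1) p.2))} with hE
  have hElt : ∀ p, P.real (E p) < B := by
    intro p
    by_cases hp : ∃ s ∈ typeClass (l * n + κ) q, (fun i => s (Fin.castAdd κ i)) = p.1
    · obtain ⟨s, hs, hsp⟩ := hp
      refine (measureReal_mono fun ω hω => ?_).trans_lt
        (measure_block_leakage_lt u q hn hl hlam c hd P Υ hmeas hindep hunif s hs p.2)
      simpa only [Set.mem_ofPred_eq, hsp] using hω.2
    · have : E p = ∅ := Set.eq_empty_of_forall_notMem fun ω hω => hp hω.1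
      rw [this, measureReal_empty]
      exact Real.exp_pos _
  have hsub : {ω | ∃ s ∈ typeClass (l * n + κ) q,
      l * T < mutualInfo ((concatPermute l c h fun w => Υ w ω).eavesLaw u s)} ⊆ ⋃ p, E p := by
    rintro ω ⟨s, hs, hlt⟩
    have hle := hlt.trans_le (mutualInfo_concatPermute_le l c h (fun w => Υ w ω) u s)
    by_contra hcon
    simp only [Set.mem_iUnion, not_exists] at hcon
    refine hle.not_ge ?_
    calc _ ≤ ∑ _j : Fin l, T := by
          refine Finset.sum_le_sum fun j _ => ?_
          by_contra hj
          exact hcon (fun i => s (Fin.castAdd κ i), j) ⟨⟨s, hs, rfl⟩, (not_le.1 hj).le⟩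
      _ = l * T := by simp
  have hSne : Nonempty S := q.support_nonempty.to_type
  have hlne : Nonempty (Fin l) := ⟨⟨0, by omega⟩⟩
  calc _ ≤ P.real (⋃ p, E p) := measureReal_mono hsub
    _ ≤ ∑ p, P.real (E p) := measureReal_iUnion_fintype_le E
    _ < ∑ _p : (Fin (l * n) → S) × Fin l, B :=
        Finset.sum_lt_sum_of_nonempty Finset.univ_nonempty fun p _ => hElt p
    _ = _ := by
        simp only [Finset.sum_const, Finset.card_univ, nsmul_eq_mul, Fintype.card_prod,
          Fintype.card_fun, Fintype.card_fin]
        push_cast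
        rw [mul_comm l n]
        ring

end Wiretap

end

theorem theorem1
    {X Y Z S M W Ω : Type*}
    [Fintype Z] [Fintype S] [Fintype M] [Nonempty M] [Fintype W] [Nonempty W]
    (t : X → PMF Y) (u : X → S → PMF Z) (q : PMF S)
    (n l κ : ℕ) (hn : 1 ≤ n) (hl : 2 ≤ l)
    (r ψ εf εg : ℝ) (δ : EReal) (lam : ℝ) (hlam : 0 < lam)
    (hq : Wiretap.IsType (l * n + κ) q)
    (hqmin : ∀ s, 4 * √(Real.log ((n : ℝ) * ((l : ℝ) - 1)) / ((n : ℝ) * ((l : ℝ) - 1)))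
      + (κ : ℝ) / ((n : ℝ) * (l : ℝ)) ≤ (q s).toReal)
    (c : Wiretap.Code X Y M n) (hc : c.IsWTCI t u q r εf δ)
    (h : Wiretap.Code X Y W κ) (hh : h.IsWTCI t u q ψ εg ⊤)
    [MeasurableSpace Ω] (P : Measure Ω) [IsProbabilityMeasure P]
    (Υ : W → Ω → Equiv.Perm (Fin (l * n)))
    (hmeas : ∀ w, Measurable (Υ w))
    (hindep : iIndepFun Υ P)
    (hunif : ∀ w, P.map (Υ w) = (PMF.uniformOfFintype (Equiv.Perm (Fin (l * n)))).toMeasure) :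
    P.real {ω | ¬ (Wiretap.concatPermute l c h (fun w => Υ w ω)).IsWTCII t u q
        (r * (1 - (κ : ℝ) / ((n : ℝ) * (l : ℝ) + (κ : ℝ))))
        ((l : ℝ) * εf + εg)
        (((l : ℝ) : EReal) *
          (((Wiretap.mu l (Fintype.card S) * Real.exp ((κ : ℝ) / (l : ℝ)) : ℝ) : EReal) * δ
            + ((lam : ℝ) : EReal)))}
      < (l : ℝ) * (Fintype.card S : ℝ) ^ (n * l) *
        Real.exp (-((2 : ℝ) ^ ((κ : ℝ) * ψ + 1) *
          (lam / ((n : ℝ) * (Fintype.card Z : ℝ))) ^ 2)) := by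
  classical
  have hXn : Nonempty (Fin n → X) :=
    (c.enc (Classical.arbitrary M)).support_nonempty.to_type
  have hX : Nonempty X := hXn.map fun x => x ⟨0, hn⟩
  have hSne : Nonempty S := q.support_nonempty.to_type
  have hZ : Nonempty Z :=
    (u (Classical.arbitrary X) (Classical.arbitrary S)).support_nonempty.to_type
  have hn0 : (0 : ℝ) < n := by exact_mod_cast hn
  have hl0 : (0 : ℝ) < l := by positivity
  have hpos : 0 < Wiretap.mu l (Fintype.card S) * Real.exp ((κ : ℝ) / (l : ℝ)) :=
    mul_pos (Wiretap.mu_pos hl _) (Real.exp_pos _)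
  have hrate : (Fintype.card (Fin l → M) : ℝ) = (2 : ℝ) ^ (((l * n + κ : ℕ) : ℝ) *
      (r * (1 - (κ : ℝ) / ((n : ℝ) * (l : ℝ) + (κ : ℝ))))) := by
    rw [Fintype.card_fun, Fintype.card_fin, Nat.cast_pow, hc.rate, ← Real.rpow_mul_natCast
      zero_le_two]
    congr 1
    have : (n : ℝ) * l + κ ≠ 0 := by positivity
    push_cast
    field_simp
    ring
  have hexp : (2 : ℝ) ^ ((κ : ℝ) * ψ + 1) = 2 * Fintype.card W := by
    rw [Real.rpow_add two_pos, Real.rpow_one, hh.rate, mul_comm]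
  rw [hexp]
  -- rate and error probability are as required for every choice of the permutations
  have hsecrecy : ∀ ω, (∀ s ∈ Wiretap.typeClass (l * n + κ) q,
      (Wiretap.mutualInfo ((Wiretap.concatPermute l c h fun w => Υ w ω).eavesLaw u s) : EReal) ≤
        ((l : ℝ) : EReal) * (((Wiretap.mu l (Fintype.card S) *
          Real.exp ((κ : ℝ) / (l : ℝ)) : ℝ) : EReal) * δ + ((lam : ℝ) : EReal))) →
      (Wiretap.concatPermute l c h (fun w => Υ w ω)).IsWTCII t u q
        (r * (1 - (κ : ℝ) / ((n : ℝ) * (l : ℝ) + (κ : ℝ)))) ((l : ℝ) * εf + εg)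
        (((l : ℝ) : EReal) * (((Wiretap.mu l (Fintype.card S) *
          Real.exp ((κ : ℝ) / (l : ℝ)) : ℝ) : EReal) * δ + ((lam : ℝ) : EReal))) :=
    fun ω hω => ⟨hrate, Wiretap.concatPermute_error l c h _ t hc.error hh.error, hω⟩
  have hd := hc.secrecy
  induction δ with
  | bot => exact absurd hd (by simp)
  | top =>
    rw [EReal.coe_mul_top_of_pos hpos, EReal.top_add_coe,
      EReal.coe_mul_top_of_pos hl0] at hsecrecy ⊢
    refine lt_of_eq_of_lt (b := 0) ?_ (by positivity)
    convert measureReal_empty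
    exact Set.eq_empty_of_forall_notMem fun ω hω => hω (hsecrecy ω fun s _ => le_top)
  | coe d =>
    refine (measureReal_mono fun ω hω => ?_).trans_lt
      (Wiretap.measure_exists_leakage_lt u q hn hl hlam c h (EReal.coe_le_coe_iff.1 hd) P Υ hmeas
        hindep hunif)
    by_contra hcon
    refine hω (hsecrecy ω fun s hs => ?_)
    rw [← EReal.coe_mul, ← EReal.coe_add, ← EReal.coe_mul, EReal.coe_le_coe_iff]
    exact le_of_not_gt fun hlt => hcon ⟨s, hs, hlt⟩
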